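/- Let $K$ be a number field, let $S$ be a finite set of places of $K$ containing all archimedean ones, and let $R=\mathcal O_S=\{a\in K : v(a)\ge 0 \text{ for all places } v\notin S\}$ be the ring of $S$-algebraic integers. Let $\mathcal P_1,\dots,\mathcal P_s$ be non-zero prime ideals of $R$ and $l_1,\dots,l_s\in\mathbb N$, and assume that at most one of the primes $\mathcal P_i$ has residue field $R/\mathcal P_i\cong\mathbb F_2$. Put $\bar R:=R/(\mathcal P_1^{l_1}\cdots\mathcal P_s^{l_s})$ and let $\bar x\in\bar R$ be a unit. (1) Let $\mathrm{Sp}_4(\bar R)$ be the group of $4\times4$ matrices over $\bar R$ preserving the form $J=\begin{pmatrix}0&I_2\\-I_2&0\end{pmatrix}$, and for the short simple root $\alpha$ of $B_2$ let $\varepsilon_\alpha(t)=I_4+t(e_{12}-e_{43})$. Then the smallest normal subgroup of $\mathrm{Sp}_4(\bar R)$ containing $\varepsilon_\alpha(\bar x)$ is $\mathrm{Sp}_4(\bar R)$ itself. (2) Let $G_2(\bar R)$ be the split Chevalley group of type $G_2$ over $\bar R$, realised as the group of $\bar R$-algebra automorphisms of the split octonion algebra over $\bar R$. This is the algebra of Zorn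 vector matrices $(a,v,w,b)$ with $a,b\in\bar R$, $v,w\in\bar R^3$ and $$(a,v,w,b)(a',v',w',b')=(aa'+v\cdot w',\;av'+b'v+w\times w',\;a'w+bw'-v\times v',\;bb'+w\cdot v').$$ For the short simple root $\alpha$ of $G_2$ let $\varepsilon_\alpha(t)$ be the automorphism which, with $u=(t,0,0)$, is given by $$\varepsilon_\alpha(t)(a,v,w,b)=(a+u\cdot w,\;v+(b-a)u-(u\cdot w)u,\;w+u\times v,\;b-u\cdot w).$$ Then the smallest normal subgroup of $G_2(\bar R)$ containing $\varepsilon_\alpha(\bar x)$ is $G_2(\bar R)$ itself. -/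

import Mathlib

open scoped Matrix

section SymplecticGroupRankTwo

/-- The root element `ε_α(t) = I₄ + t (e₁₂ - e₄₃)` of `Sp₄(R)`, where `α` is the short simple root
of `B₂ = C₂`. The four indices `1, 2, 3, 4` are `inl 0, inl 1, inr 0, inr 1` in
`Fin 2 ⊕ Fin 2`, the index type on which the symplectic form has the block shape
`(0, -I₂; I₂, 0)`. -/
def sp4RootElement {R : Type*} [CommRing R] (t : R) : Matrix.symplecticGroup (Fin 2) R :=
  ⟨Matrix.fromBlocks !![1, t; 0, 1] 0 0 !![1, 0; -t, 1], by
    rw [SymplecticGroup.mem_iff, Matrix.J, Matrix.fromBlocks_transpose,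
      Matrix.fromBlocks_multiply, Matrix.fromBlocks_multiply]
    congr 1 <;> (ext i j; fin_cases i <;> fin_cases j <;>
      simp [Matrix.vecMul, dotProduct, Fin.sum_univ_two])⟩

end SymplecticGroupRankTwo

section OctonionsAndGTwo

/-- The free module of rank `8` underlying Zorn's vector matrix algebra over `R`. The quadruple
`(a, v, w, b)` is the vector matrix with diagonal entries `a`, `b` in `R` and off-diagonal
entries `v` (upper right) and `w` (lower left) in `R³`. -/
abbrev Zorn (R : Type*) : Type _ := R × (Fin 3 → R) × (Fin 3 → R) × R

/-- The multiplication of Zorn's vector matrix algebra. With it, `Zorn R` is the split octonion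
algebra over `R`; its unit is `(1, 0, 0, 1)` and its multiplicative norm is
`(a, v, w, b) ↦ a * b - v ⬝ᵥ w`. -/
def zornMul {R : Type*} [CommRing R] (x y : Zorn R) : Zorn R :=
  (x.1 * y.1 + x.2.1 ⬝ᵥ y.2.2.1,
   x.1 • y.2.1 + y.2.2.2 • x.2.1 + x.2.2.1 ⨯₃ y.2.2.1,
   y.1 • x.2.2.1 + x.2.2.2 • y.2.2.1 - x.2.1 ⨯₃ y.2.1,
   x.2.2.2 * y.2.2.2 + x.2.2.1 ⬝ᵥ y.2.1)

/-- The group `G₂(R)` of `R`-points of the split (simply connected) Chevalley group scheme of type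
`G₂`: the group of all `R`-algebra automorphisms of the split octonion algebra over `R`, a subgroup
of `GL₈(R)`. (A bijective multiplicative map automatically fixes the unit.) -/
def G2 (R : Type*) [CommRing R] : Subgroup (Zorn R ≃ₗ[R] Zorn R) where
  carrier := {f | ∀ x y, f (zornMul x y) = zornMul (f x) (f y)}
  mul_mem' {f g} hf hg x y := by
    simp only [Set.mem_ofPred_eq] at hf hg
    rw [LinearEquiv.mul_apply, hg, hf]; rfl
  one_mem' _ _ := rfl
  inv_mem' {f} hf x y := by
    simp only [Set.mem_ofPred_eq] at hf
    apply f.injective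
    have h : ∀ z, f (f⁻¹ z) = z := fun z => f.apply_symm_apply z
    rw [hf, h, h, h]

/-- Underlying map of the root element `ε_α(t)` of `G₂(R)`. With `u = t e₁`, it is
`exp(D) = 1 + D + D² / 2`, where
`D (a, v, w, b) = (u ⬝ᵥ w, (b - a) • u, u ⨯₃ v, -(u ⬝ᵥ w))` is a derivation of the octonions
with `D³ = 0` and `(D² / 2) (a, v, w, b) = (0, -(u ⬝ᵥ w) • u, 0, 0)`. -/
def g2RootFun {R : Type*} [CommRing R] (t : R) (x : Zorn R) : Zorn R :=
  (x.1 + ![t, 0, 0] ⬝ᵥ x.2.2.1,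
   x.2.1 + (x.2.2.2 - x.1) • ![t, 0, 0] - (![t, 0, 0] ⬝ᵥ x.2.2.1) • ![t, 0, 0],
   x.2.2.1 + ![t, 0, 0] ⨯₃ x.2.1,
   x.2.2.2 - ![t, 0, 0] ⬝ᵥ x.2.2.1)

theorem g2RootFun_add {R : Type*} [CommRing R] (s t : R) (x : Zorn R) :
    g2RootFun s (g2RootFun t x) = g2RootFun (s + t) x := by
  obtain ⟨a, v, w, b⟩ := x
  refine Prod.ext ?_ (Prod.ext ?_ (Prod.ext ?_ ?_))
  · simp [g2RootFun, dotProduct, Fin.sum_univ_three, cross_apply, Matrix.vecHead, Matrix.vecTail]; ring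
  · ext i; fin_cases i <;> simp [g2RootFun, dotProduct, Fin.sum_univ_three, cross_apply, Matrix.vecHead, Matrix.vecTail]
    ring
  · ext i; fin_cases i <;> simp [g2RootFun, dotProduct, Fin.sum_univ_three, cross_apply, Matrix.vecHead, Matrix.vecTail] <;> ring
  · simp [g2RootFun, dotProduct, Fin.sum_univ_three, cross_apply, Matrix.vecHead, Matrix.vecTail]; ring

theorem g2RootFun_zero {R : Type*} [CommRing R] (x : Zorn R) : g2RootFun 0 x = x := by
  obtain ⟨a, v, w, b⟩ := x
  refine Prod.ext ?_ (Prod.ext ?_ (Prod.ext ?_ ?_))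
  · simp [g2RootFun, dotProduct, Fin.sum_univ_three, cross_apply, Matrix.vecHead, Matrix.vecTail]
  · ext i; fin_cases i <;> simp [g2RootFun, dotProduct, Fin.sum_univ_three, cross_apply, Matrix.vecHead, Matrix.vecTail]
  · ext i; fin_cases i <;> simp [g2RootFun, dotProduct, Fin.sum_univ_three, cross_apply, Matrix.vecHead, Matrix.vecTail]
  · simp [g2RootFun, dotProduct, Fin.sum_univ_three, cross_apply, Matrix.vecHead, Matrix.vecTail]

theorem g2RootFun_mul {R : Type*} [CommRing R] (t : R) (x y : Zorn R) :
    g2RootFun t (zornMul x y) = zornMul (g2RootFun t x) (g2RootFun t y) := by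
  obtain ⟨a, v, w, b⟩ := x
  obtain ⟨a', v', w', b'⟩ := y
  refine Prod.ext ?_ (Prod.ext ?_ (Prod.ext ?_ ?_))
  · simp [g2RootFun, zornMul, dotProduct, Fin.sum_univ_three, cross_apply, Matrix.vecHead, Matrix.vecTail]; ring
  · ext i; fin_cases i <;>
      simp [g2RootFun, zornMul, dotProduct, Fin.sum_univ_three, cross_apply, Matrix.vecHead, Matrix.vecTail] <;> ring
  · ext i; fin_cases i <;>
      simp [g2RootFun, zornMul, dotProduct, Fin.sum_univ_three, cross_apply, Matrix.vecHead, Matrix.vecTail] <;> ring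
  · simp [g2RootFun, zornMul, dotProduct, Fin.sum_univ_three, cross_apply, Matrix.vecHead, Matrix.vecTail]; ring

/-- The root element `ε_α(t)` of `G₂(R)`, where `α` is the short simple root. The maximal torus is
the diagonal torus of `SL₃`, where `g` in `SL₃(R)` acts on the octonions by
`(a, v, w, b) ↦ (a, g v, (gᵀ)⁻¹ w, b)`. If `χ₁, χ₂, χ₃` are its coordinate characters
(`χ₁ + χ₂ + χ₃ = 0`), then the short roots are `± χᵢ`, the long roots are `χᵢ - χⱼ`, the short
simple root is `α = χ₁` and the long simple root is `β = χ₂ - χ₁`. -/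
def g2RootElement {R : Type*} [CommRing R] (t : R) : G2 R :=
  ⟨{ toFun := g2RootFun t
     invFun := g2RootFun (-t)
     left_inv := fun x => by rw [g2RootFun_add, neg_add_cancel, g2RootFun_zero]
     right_inv := fun x => by rw [g2RootFun_add, add_neg_cancel, g2RootFun_zero]
     map_add' := fun x y => by
      obtain ⟨a, v, w, b⟩ := x
      obtain ⟨a', v', w', b'⟩ := y
      refine Prod.ext ?_ (Prod.ext ?_ (Prod.ext ?_ ?_))
      · simp [g2RootFun, dotProduct, Fin.sum_univ_three, cross_apply, Matrix.vecHead, Matrix.vecTail]; ring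
      · ext i; fin_cases i <;> simp [g2RootFun, dotProduct, Fin.sum_univ_three, cross_apply, Matrix.vecHead, Matrix.vecTail]
        ring
      · ext i; fin_cases i <;>
          simp [g2RootFun, dotProduct, Fin.sum_univ_three, cross_apply, Matrix.vecHead, Matrix.vecTail] <;> ring
      · simp [g2RootFun, dotProduct, Fin.sum_univ_three, cross_apply, Matrix.vecHead, Matrix.vecTail]; ring
     map_smul' := fun c x => by
      obtain ⟨a, v, w, b⟩ := x
      refine Prod.ext ?_ (Prod.ext ?_ (Prod.ext ?_ ?_))
      · simp [g2RootFun, dotProduct, Fin.sum_univ_three, cross_apply, Matrix.vecHead, Matrix.vecTail]; ring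
      · ext i; fin_cases i <;> simp [g2RootFun, dotProduct, Fin.sum_univ_three, cross_apply, Matrix.vecHead, Matrix.vecTail]
        ring
      · ext i; fin_cases i <;>
          simp [g2RootFun, dotProduct, Fin.sum_univ_three, cross_apply, Matrix.vecHead, Matrix.vecTail] <;> ring
      · simp [g2RootFun, dotProduct, Fin.sum_univ_three, cross_apply, Matrix.vecHead, Matrix.vecTail]; ring },
   fun x y => g2RootFun_mul t x y⟩

end OctonionsAndGTwo

/-! ### Semilocal rings: approximation, stable range one, and the effect of the residue field
condition. -/

section Semilocal

variable {R : Type*} [CommRing R]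

/-! The quotient ring `R̄` is semilocal: non-zero primes of `R` are maximal, so the maximal ideals
of `R̄` lie over the finitely many `P i`. Semilocality gives stable range one, and hence any
subgroup of `Sp₄` or `G₂` containing all root elements is the whole group. It remains to put every
root element into the normal closure `N` of one short root element with unit parameter.

In both types, commutators and conjugations show that the parameters `t` of the root elements of one
root that lie in `N` form (up to scaling by a unit) an additive group `A` which contains a unit and
every `(a² - a) c`. The ideal `I` generated by all `a² - a` lies only in maximal ideals with residue
field `𝔽₂`. There is at most one of these, so `R̄/I` is zero or `𝔽₂`, and `I` together with a unit
spans `R̄` additively. This is `AddSubgroup.eq_top_of_sq_sub_self_mul_mem`, the only use of the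
residue field hypothesis.

For `Sp₄` the elements `(a² - a) c` appear among long root parameters. For `G₂` the commutator
formulas first give long root elements with parameters `3t` and then `2t`, hence all of them; modulo
these, a short root element with parameter `ac` is congruent to one with parameter `a² c`.

Generation of `Sp₄` is column reduction on a hyperbolic pair. For `G₂`, the orbit of the idempotent
`(1, 0, 0, 0)` is treated by short root elements, and its stabilizer is `SL₃`, reduced by
transvections (`ContainsG2RootElements.eq_top`). -/

theorem exists_sub_mem_maximalSpectrum [Finite (MaximalSpectrum R)] (f : MaximalSpectrum R → R) :
    ∃ r, ∀ m : MaximalSpectrum R, r - f m ∈ m.asIdeal := by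
  refine Ideal.exists_forall_sub_mem_ideal (I := fun m : MaximalSpectrum R => m.asIdeal) ?_ f
  intro m m' hne
  exact Ideal.isCoprime_of_isMaximal (fun h => hne (MaximalSpectrum.ext h))

theorem isUnit_of_forall_notMem_maximalSpectrum {a : R}
    (h : ∀ m : MaximalSpectrum R, a ∉ m.asIdeal) : IsUnit a := by
  by_contra ha
  obtain ⟨m, hm, ham⟩ := exists_max_ideal_of_mem_nonunits ha
  exact h ⟨m, hm⟩ ham

/-- A vector with prescribed residues modulo all maximal ideals of a semilocal ring. -/
theorem exists_sub_mem_maximalSpectrum_pi [Finite (MaximalSpectrum R)] {ι : Type*}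
    (f : MaximalSpectrum R → ι → R) :
    ∃ r : ι → R, ∀ (m : MaximalSpectrum R) (i : ι), r i - f m i ∈ m.asIdeal := by
  choose r hr using fun i => exists_sub_mem_maximalSpectrum fun m => f m i
  exact ⟨r, fun m i => hr i m⟩

/-- Semilocal rings have stable range one. -/
theorem exists_isUnit_add_dotProduct [Finite (MaximalSpectrum R)] {ι : Type*} [Fintype ι]
    (a : R) (b : ι → R)
    (h : ∀ m : MaximalSpectrum R, a ∈ m.asIdeal → ∃ i, b i ∉ m.asIdeal) :
    ∃ c : ι → R, IsUnit (a + c ⬝ᵥ b) := by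
  classical
  have key : ∀ m : MaximalSpectrum R, ∃ c : ι → R, a + c ⬝ᵥ b ∉ m.asIdeal := by
    intro m
    by_cases ha : a ∈ m.asIdeal
    · obtain ⟨i, hi⟩ := h m ha
      refine ⟨Pi.single i 1, fun hmem => hi ?_⟩
      simpa using (m.asIdeal.sub_mem hmem ha)
    · exact ⟨0, by simpa using ha⟩
  choose c hc using key
  obtain ⟨r, hr⟩ := exists_sub_mem_maximalSpectrum_pi c
  refine ⟨r, isUnit_of_forall_notMem_maximalSpectrum fun m hm => hc m ?_⟩
  have h1 : (r - c m) ⬝ᵥ b ∈ m.asIdeal :=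
    m.asIdeal.sum_mem fun i _ => m.asIdeal.mul_mem_right _ (hr m i)
  have h2 := m.asIdeal.sub_mem hm h1
  rwa [sub_dotProduct, add_sub_assoc, sub_sub_cancel] at h2

/-- At most one residue field of `R` has two elements. -/
def AtMostOneResidueFieldTwo (R : Type*) [CommRing R] : Prop :=
  ∀ m m' : MaximalSpectrum R, (∀ a : R, a ^ 2 - a ∈ m.asIdeal) →
    (∀ a : R, a ^ 2 - a ∈ m'.asIdeal) → m = m'

/-- Modulo the ideal `I` of all `a² - a` every element is idempotent, and by `hR` at most one
maximal ideal contains `I`; hence `R/I` is zero or `𝔽₂`. Then `A` contains `I` and a representative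
`u` of the class of `1`. -/
theorem AddSubgroup.eq_top_of_sq_sub_self_mul_mem (hR : AtMostOneResidueFieldTwo R)
    (A : AddSubgroup R) (hA : ∀ a c : R, (a ^ 2 - a) * c ∈ A) {u : R} (hu : IsUnit u)
    (huA : u ∈ A) : A = ⊤ := by
  set I : Ideal R := Ideal.span (Set.range fun a : R => a ^ 2 - a) with hI
  have hmem : ∀ a : R, a ^ 2 - a ∈ I := fun a => Ideal.subset_span ⟨a, rfl⟩
  have hIA : ∀ r ∈ I, r ∈ A := by
    intro r hr
    suffices h : ∀ c, c * r ∈ A by simpa using h 1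
    refine Submodule.span_induction (p := fun r _ => ∀ c, c * r ∈ A) ?_ ?_ ?_ ?_ hr
    · rintro _ ⟨a, rfl⟩ c
      rw [mul_comm]
      exact hA a c
    · intro c
      simp
    · intro r s _ _ h1 h2 c
      rw [mul_add]
      exact A.add_mem (h1 c) (h2 c)
    · intro d r _ h c
      rw [smul_eq_mul, ← mul_assoc]
      exact h _
  have hbool : ∀ r : R, I ⊔ Ideal.span {r} = ⊤ → r - 1 ∈ I := by
    intro r hr
    have h1 : (1 : R) ∈ I ⊔ Ideal.span {r} := hr ▸ Submodule.mem_top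
    obtain ⟨i, hi, j, hj, hij⟩ := Submodule.mem_sup.1 h1
    obtain ⟨t, rfl⟩ := Ideal.mem_span_singleton'.1 hj
    -- A unit idempotent is `1`: multiply `i + t * r = 1` by `r - 1`.
    have : r - 1 = (r - 1) * i + t * (r ^ 2 - r) := by linear_combination (1 - r) * hij
    rw [this]
    exact I.add_mem (I.mul_mem_left _ hi) (I.mul_mem_left _ (hmem r))
  have hdich : ∀ r : R, r ∈ I ∨ r - 1 ∈ I := by
    intro r
    by_cases h1 : I ⊔ Ideal.span {r} = ⊤
    · exact Or.inr (hbool r h1)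
    by_cases h2 : I ⊔ Ideal.span {1 - r} = ⊤
    · left
      have := hbool _ h2
      rw [sub_sub_cancel_left] at this
      exact neg_mem_iff.1 this
    exfalso
    -- If neither `r` nor `1 - r` is a unit modulo `I`, two maximal ideals over `I` contain them;
    -- these coincide and so contain `1`.
    obtain ⟨m, hm, hle⟩ := Ideal.exists_le_maximal _ h1
    obtain ⟨m', hm', hle'⟩ := Ideal.exists_le_maximal _ h2
    have heq := hR ⟨m, hm⟩ ⟨m', hm'⟩ (fun a => hle (Ideal.mem_sup_left (hmem a)))
      (fun a => hle' (Ideal.mem_sup_left (hmem a)))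
    obtain rfl : m = m' := congrArg MaximalSpectrum.asIdeal heq
    apply hm.ne_top
    rw [Ideal.eq_top_iff_one]
    have h3 := m.add_mem (hle (Ideal.mem_sup_right (Ideal.mem_span_singleton_self r)))
      (hle' (Ideal.mem_sup_right (Ideal.mem_span_singleton_self (1 - r))))
    rwa [add_sub_cancel] at h3
  have hu1 : u - 1 ∈ I := by
    rcases hdich u with h | h
    · rw [Ideal.eq_top_of_isUnit_mem I h hu]
      trivial
    · exact h
  rw [eq_top_iff]
  intro r _
  rcases hdich r with h | h
  · exact hIA r h
  · have h1 := hIA _ (I.sub_mem h hu1)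
    have h2 := A.add_mem h1 huA
    rwa [show r - 1 - (u - 1) + u = r by ring] at h2

end Semilocal

/-! ### From `S`-integers to a semilocal quotient. -/

section SIntegers

open IsDedekindDomain

/-- The contraction `p` of `P` to the ring of integers is non-zero, by clearing denominators, hence
maximal. An ideal strictly above `P` contains an integer outside `p`, and with `p` this generates
`1`. -/
theorem isMaximal_of_isPrime_integer {K : Type*} [Field K] [NumberField K]
    (S : Set (HeightOneSpectrum (NumberField.RingOfIntegers K)))
    (P : Ideal (S.integer K)) [hP : P.IsPrime] (hne : P ≠ ⊥) : P.IsMaximal := by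
  set O := NumberField.RingOfIntegers K
  set p : Ideal O := P.comap (algebraMap O (S.integer K)) with hp
  have hcoe : ∀ a : O, ((algebraMap O (S.integer K) a : S.integer K) : K) = algebraMap O K a :=
    fun _ => rfl
  have hp0 : p ≠ ⊥ := by
    obtain ⟨r, hrP, hr0⟩ := Submodule.exists_mem_ne_zero_of_ne_bot hne
    obtain ⟨a, b, hb, hab⟩ := IsFractionRing.div_surjective (A := O) (r : K)
    have hb0 : algebraMap O K b ≠ 0 := IsFractionRing.to_map_ne_zero_of_mem_nonZeroDivisors hb
    have h1 : algebraMap O (S.integer K) a = r * algebraMap O (S.integer K) b := by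
      apply Subtype.ext
      rw [hcoe, MulMemClass.coe_mul, hcoe, ← hab, div_mul_cancel₀ _ hb0]
    have ha : a ∈ p := by
      rw [hp, Ideal.mem_comap, h1]
      exact P.mul_mem_right _ hrP
    intro hbot
    rw [hbot, Ideal.mem_bot] at ha
    apply hr0
    apply Subtype.ext
    rw [← hab, ha]
    simp
  have hpp : p.IsPrime := Ideal.comap_isPrime _ _
  have hpm : p.IsMaximal := hpp.isMaximal hp0
  let v : HeightOneSpectrum O := ⟨p, hpp, hp0⟩
  rw [Ideal.isMaximal_iff]
  refine ⟨fun h => hP.ne_top ((Ideal.eq_top_iff_one _).2 h), fun J r hPJ hrP hrJ => ?_⟩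
  suffices h : ∃ a ∈ J.comap (algebraMap O (S.integer K)), a ∉ p by
    obtain ⟨a, haJ, hap⟩ := h
    obtain ⟨b, i, hi, hbi⟩ := hpm.exists_inv hap
    have h1 := congrArg (algebraMap O (S.integer K)) hbi
    rw [map_add, map_mul, map_one] at h1
    rw [← h1]
    exact J.add_mem (J.mul_mem_left _ haJ) (hPJ hi)
  -- The localization at `p` is a valuation ring, so `r` or its inverse has a denominator `d` prime
  -- to `p`; either way the numerator of `r` is an integer in `J` but not in `p`.
  obtain ⟨a, d, h⟩ := v.exists_primeCompl_mul_eq_or_mul_eq (r : K)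
  have hdp : (d : O) ∉ p := d.2
  rcases h with h | h
  · have h1 : algebraMap O (S.integer K) a = r * algebraMap O (S.integer K) d := by
      apply Subtype.ext
      rw [hcoe, MulMemClass.coe_mul, hcoe, h]
    refine ⟨a, ?_, fun hap => ?_⟩
    · rw [Ideal.mem_comap, h1]
      exact J.mul_mem_right _ hrJ
    · rw [hp, Ideal.mem_comap, h1] at hap
      rcases hP.mem_or_mem hap with h2 | h2
      · exact hrP h2
      · exact hdp h2
  · have h1 : algebraMap O (S.integer K) d = r * algebraMap O (S.integer K) a := by
      apply Subtype.ext
      rw [hcoe, MulMemClass.coe_mul, hcoe, h]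
    refine ⟨d, ?_, hdp⟩
    rw [Ideal.mem_comap, h1]
    exact J.mul_mem_right _ hrJ

/-- The residue ring of a prime ideal that contains all `a² - a` is the field with two elements. -/
theorem nonempty_ringEquiv_zmod_two {A : Type*} [CommRing A] (I : Ideal A) [hI : I.IsPrime]
    (h : ∀ a : A, a ^ 2 - a ∈ I) : Nonempty ((A ⧸ I) ≃+* ZMod 2) := by
  have h01 : ∀ y : A ⧸ I, y = 0 ∨ y = 1 := by
    intro y
    obtain ⟨a, rfl⟩ := Ideal.Quotient.mk_surjective y
    have h1 := Ideal.Quotient.eq_zero_iff_mem.2 (h a)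
    rw [map_sub, map_pow] at h1
    have h2 : Ideal.Quotient.mk I a * (Ideal.Quotient.mk I a - 1) = 0 := by
      linear_combination h1
    rcases mul_eq_zero.1 h2 with h3 | h3
    · exact Or.inl h3
    · exact Or.inr (sub_eq_zero.1 h3)
  have h2 : (2 : A ⧸ I) = 0 := by
    rcases h01 2 with h3 | h3
    · exact h3
    · exact absurd (show (1 : A ⧸ I) = 0 by linear_combination h3) one_ne_zero
  have : CharP (A ⧸ I) 2 := CharTwo.of_one_ne_zero_of_two_eq_zero one_ne_zero h2
  refine ⟨(RingEquiv.ofBijective (ZMod.castHom (dvd_refl 2) (A ⧸ I)) ⟨?_, ?_⟩).symm⟩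
  · exact ZMod.castHom_injective _
  · intro y
    rcases h01 y with rfl | rfl
    · exact ⟨0, map_zero _⟩
    · exact ⟨1, map_one _⟩

section ProductOfPrimes

variable {A : Type*} [CommRing A] {s : ℕ} (P : Fin s → Ideal A) (l : Fin s → ℕ)

theorem exists_comap_eq_of_isMaximal (hP : ∀ i, (P i).IsMaximal)
    (m : MaximalSpectrum (A ⧸ ∏ i, P i ^ l i)) :
    ∃ i, P i = m.asIdeal.comap (Ideal.Quotient.mk (∏ i, P i ^ l i)) := by
  have hm := m.isMaximal
  have hprime : (m.asIdeal.comap (Ideal.Quotient.mk (∏ i, P i ^ l i))).IsPrime :=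
    Ideal.comap_isPrime _ _
  have hle : ∏ i, P i ^ l i ≤ m.asIdeal.comap (Ideal.Quotient.mk (∏ i, P i ^ l i)) := by
    intro r hr
    rw [Ideal.mem_comap, Ideal.Quotient.eq_zero_iff_mem.2 hr]
    exact Ideal.zero_mem _
  obtain ⟨i, -, hi⟩ := (Ideal.IsPrime.prod_le hprime).1 hle
  exact ⟨i, (hP i).eq_of_le hprime.ne_top (Ideal.IsPrime.le_of_pow_le hi)⟩

theorem maximalSpectrum_ext_comap {I : Ideal A} {m m' : MaximalSpectrum (A ⧸ I)}
    (h : m.asIdeal.comap (Ideal.Quotient.mk I) = m'.asIdeal.comap (Ideal.Quotient.mk I)) :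
    m = m' :=
  MaximalSpectrum.ext (Ideal.comap_injective_of_surjective _ Ideal.Quotient.mk_surjective h)

theorem finite_maximalSpectrum_quotient_prod (hP : ∀ i, (P i).IsMaximal) :
    Finite (MaximalSpectrum (A ⧸ ∏ i, P i ^ l i)) := by
  choose f hf using exists_comap_eq_of_isMaximal P l hP
  refine Finite.of_injective f fun m m' h => maximalSpectrum_ext_comap ?_
  rw [← hf, ← hf, h]

theorem atMostOneResidueFieldTwo_quotient_prod (hP : ∀ i, (P i).IsMaximal)
    (htwo : ∀ i j, Nonempty ((A ⧸ P i) ≃+* ZMod 2) →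
      Nonempty ((A ⧸ P j) ≃+* ZMod 2) → P i = P j) :
    AtMostOneResidueFieldTwo (A ⧸ ∏ i, P i ^ l i) := by
  have key : ∀ m : MaximalSpectrum (A ⧸ ∏ i, P i ^ l i), (∀ a, a ^ 2 - a ∈ m.asIdeal) →
      ∀ i, P i = m.asIdeal.comap (Ideal.Quotient.mk (∏ i, P i ^ l i)) →
        Nonempty ((A ⧸ P i) ≃+* ZMod 2) := by
    intro m hm i hi
    have := (hP i).isPrime
    refine nonempty_ringEquiv_zmod_two (P i) fun a => ?_
    rw [hi, Ideal.mem_comap, map_sub, map_pow]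
    exact hm _
  intro m m' hm hm'
  obtain ⟨i, hi⟩ := exists_comap_eq_of_isMaximal P l hP m
  obtain ⟨j, hj⟩ := exists_comap_eq_of_isMaximal P l hP m'
  refine maximalSpectrum_ext_comap ?_
  rw [← hi, ← hj]
  exact htwo i j (key m hm i hi) (key m' hm' j hj)

end ProductOfPrimes

end SIntegers

/-! ### Generation of `Sp₄` over a semilocal ring by root elements. -/

section SymplecticGeneration

variable {R : Type*}

/-- The vector `(a, b, c, d)` of `R⁴`, indexed by `Fin 2 ⊕ Fin 2`. -/
def sp4Vec (a b c d : R) : Fin 2 ⊕ Fin 2 → R := Sum.elim ![a, b] ![c, d]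

theorem exists_eq_sp4Vec (x : Fin 2 ⊕ Fin 2 → R) : ∃ a b c d, x = sp4Vec a b c d := by
  refine ⟨x (.inl 0), x (.inl 1), x (.inr 0), x (.inr 1), ?_⟩
  ext (i | i) <;> fin_cases i <;> rfl

theorem sp4Vec_inj {a b c d a' b' c' d' : R} :
    sp4Vec a b c d = sp4Vec a' b' c' d' ↔ a = a' ∧ b = b' ∧ c = c' ∧ d = d' := by
  constructor
  · intro h
    exact ⟨congrFun h (.inl 0), congrFun h (.inl 1), congrFun h (.inr 0), congrFun h (.inr 1)⟩
  · rintro ⟨rfl, rfl, rfl, rfl⟩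
    rfl

variable [CommRing R]

theorem symplecticGroup_smul_def (g : Matrix.symplecticGroup (Fin 2) R)
    (x : Fin 2 ⊕ Fin 2 → R) : g • x = g.1 *ᵥ x := rfl

/-- The symplectic form on `R⁴`. -/
def sp4Form (x y : Fin 2 ⊕ Fin 2 → R) : R :=
  x (.inl 0) * y (.inr 0) + x (.inl 1) * y (.inr 1) - x (.inr 0) * y (.inl 0)
    - x (.inr 1) * y (.inl 1)

theorem sp4Form_eq (x y : Fin 2 ⊕ Fin 2 → R) :
    sp4Form x y = - (x ⬝ᵥ (Matrix.J (Fin 2) R *ᵥ y)) := by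
  obtain ⟨a, b, c, d, rfl⟩ := exists_eq_sp4Vec x
  obtain ⟨a', b', c', d', rfl⟩ := exists_eq_sp4Vec y
  simp only [sp4Form, sp4Vec, Matrix.J, Matrix.fromBlocks_mulVec]
  simp [dotProduct, Fin.sum_univ_two, Matrix.neg_mulVec]
  ring

theorem sp4Form_smul (g : Matrix.symplecticGroup (Fin 2) R) (x y : Fin 2 ⊕ Fin 2 → R) :
    sp4Form (g • x) (g • y) = sp4Form x y := by
  have hg := SymplecticGroup.mem_iff'.1 g.2
  rw [sp4Form_eq, sp4Form_eq, symplecticGroup_smul_def, symplecticGroup_smul_def,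
    Matrix.mulVec_mulVec, ← Matrix.vecMul_transpose, ← Matrix.dotProduct_mulVec,
    Matrix.mulVec_mulVec, ← Matrix.mul_assoc, hg]

theorem sp4Form_vec (a b c d a' b' c' d' : R) :
    sp4Form (sp4Vec a b c d) (sp4Vec a' b' c' d') = a * c' + b * d' - c * a' - d * b' := rfl

/-- The unipotent block matrix with symmetric upper right block `(p, q; q, r)`. -/
def sp4Upper (p q r : R) : Matrix.symplecticGroup (Fin 2) R :=
  ⟨Matrix.fromBlocks 1 !![p, q; q, r] 0 1, by
    rw [SymplecticGroup.fromBlocks_mem_iff]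
    refine ⟨by simp, ?_, by simp⟩
    ext i j; fin_cases i <;> fin_cases j <;> simp⟩

/-- The unipotent block matrix with symmetric lower left block `(p, q; q, r)`. -/
def sp4Lower (p q r : R) : Matrix.symplecticGroup (Fin 2) R :=
  ⟨Matrix.fromBlocks 1 0 !![p, q; q, r] 1, by
    rw [SymplecticGroup.fromBlocks_mem_iff]
    refine ⟨?_, by simp, by simp⟩
    ext i j; fin_cases i <;> fin_cases j <;> simp⟩

/-- The root element for the negative of the short simple root. -/
def sp4NegRootElement (t : R) : Matrix.symplecticGroup (Fin 2) R :=
  ⟨Matrix.fromBlocks !![1, 0; t, 1] 0 0 !![1, -t; 0, 1], by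
    rw [SymplecticGroup.fromBlocks_mem_iff]
    refine ⟨by simp, by simp, ?_⟩
    ext i j; fin_cases i <;> fin_cases j <;> simp [Matrix.mul_apply, Fin.sum_univ_two]⟩

theorem sp4Upper_smul (p q r a b c d : R) : sp4Upper p q r • sp4Vec a b c d =
    sp4Vec (a + p * c + q * d) (b + q * c + r * d) c d := by
  rw [symplecticGroup_smul_def]
  simp only [sp4Upper, sp4Vec, Matrix.fromBlocks_mulVec]
  ext (i | i) <;> fin_cases i <;> simp [Matrix.vecHead, Matrix.vecTail] <;> ring

theorem sp4Lower_smul (p q r a b c d : R) : sp4Lower p q r • sp4Vec a b c d =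
    sp4Vec a b (c + p * a + q * b) (d + q * a + r * b) := by
  rw [symplecticGroup_smul_def]
  simp only [sp4Lower, sp4Vec, Matrix.fromBlocks_mulVec]
  ext (i | i) <;> fin_cases i <;> simp [Matrix.vecHead, Matrix.vecTail] <;> ring

theorem sp4RootElement_smul (t a b c d : R) : sp4RootElement t • sp4Vec a b c d =
    sp4Vec (a + t * b) b c (d - t * c) := by
  rw [symplecticGroup_smul_def]
  simp only [sp4RootElement, sp4Vec, Matrix.fromBlocks_mulVec]
  ext (i | i) <;> fin_cases i <;> simp [Matrix.vecHead, Matrix.vecTail] <;> ring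

theorem sp4NegRootElement_smul (t a b c d : R) : sp4NegRootElement t • sp4Vec a b c d =
    sp4Vec a (b + t * a) (c - t * d) d := by
  rw [symplecticGroup_smul_def]
  simp only [sp4NegRootElement, sp4Vec, Matrix.fromBlocks_mulVec]
  ext (i | i) <;> fin_cases i <;> simp [Matrix.vecHead, Matrix.vecTail] <;> ring

theorem symplecticGroup_ext_smul {g h : Matrix.symplecticGroup (Fin 2) R}
    (H : ∀ a b c d : R, g • sp4Vec a b c d = h • sp4Vec a b c d) : g = h := by
  apply Subtype.ext
  apply Matrix.mulVec_injective
  ext1 x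
  obtain ⟨a, b, c, d, rfl⟩ := exists_eq_sp4Vec x
  exact H a b c d

theorem symplecticGroup_eq_one {g : Matrix.symplecticGroup (Fin 2) R}
    (h1 : g • sp4Vec (1 : R) 0 0 0 = sp4Vec 1 0 0 0)
    (h2 : g • sp4Vec (0 : R) 1 0 0 = sp4Vec 0 1 0 0)
    (h3 : g • sp4Vec (0 : R) 0 1 0 = sp4Vec 0 0 1 0)
    (h4 : g • sp4Vec (0 : R) 0 0 1 = sp4Vec 0 0 0 1) : g = 1 := by
  refine symplecticGroup_ext_smul fun a b c d => ?_
  rw [one_smul]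
  have hlin : sp4Vec a b c d = a • sp4Vec 1 0 0 0 + b • sp4Vec 0 1 0 0 + c • sp4Vec 0 0 1 0
      + d • sp4Vec 0 0 0 1 := by
    ext (i | i) <;> fin_cases i <;> simp [sp4Vec]
  simp only [symplecticGroup_smul_def] at *
  rw [hlin]
  simp only [Matrix.mulVec_add, Matrix.mulVec_smul, h1, h2, h3, h4]

/-- A subgroup of `Sp₄(R)` that contains all root elements. -/
structure ContainsSp4RootElements (H : Subgroup (Matrix.symplecticGroup (Fin 2) R)) : Prop where
  root : ∀ t, sp4RootElement t ∈ H
  negRoot : ∀ t, sp4NegRootElement t ∈ H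
  upper : ∀ p q r, sp4Upper p q r ∈ H
  lower : ∀ p q r, sp4Lower p q r ∈ H

theorem exists_mul_smul_eq {G X : Type*} [Group G] [MulAction G X] {H : Subgroup G} {v w w' : X}
    {k : G} (hk : k ∈ H) (h : ∃ h ∈ H, h • w = w') (hkv : k • v = w) : ∃ h ∈ H, h • v = w' := by
  obtain ⟨h, hh, rfl⟩ := h
  exact ⟨h * k, H.mul_mem hh hk, by rw [mul_smul, hkv]⟩

variable {H : Subgroup (Matrix.symplecticGroup (Fin 2) R)}

/-- The unit `a` clears the other coordinates. It is turned into `1` without torus elements: place a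
`1` in the dual coordinate, use it to change `a` to `1`, then remove it. -/
theorem ContainsSp4RootElements.exists_smul_eq_of_isUnit (hH : ContainsSp4RootElements H)
    {a b c d : R} (ha : IsUnit a) : ∃ h ∈ H, h • sp4Vec a b c d = sp4Vec 1 0 0 0 := by
  obtain ⟨u, hu⟩ := ha.exists_left_inv
  refine exists_mul_smul_eq (hH.negRoot (-(b * u))) (w := sp4Vec a 0 (c + b * u * d) d) ?_ ?_
  swap
  · rw [sp4NegRootElement_smul, sp4Vec_inj]
    exact ⟨rfl, by linear_combination -b * hu, by ring, rfl⟩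
  refine exists_mul_smul_eq (hH.lower (u - (c + b * u * d) * u) (-(d * u)) 0)
    (w := sp4Vec a 0 1 0) ?_ ?_
  swap
  · rw [sp4Lower_smul, sp4Vec_inj]
    exact ⟨rfl, rfl, by linear_combination (1 - c - b * u * d) * hu, by linear_combination -d * hu⟩
  refine exists_mul_smul_eq (hH.upper (1 - a) 0 0) (w := sp4Vec 1 0 1 0) ?_ ?_
  swap
  · rw [sp4Upper_smul, sp4Vec_inj]
    exact ⟨by ring, by ring, rfl, rfl⟩
  refine ⟨_, hH.lower (-1) 0 0, ?_⟩
  rw [sp4Lower_smul, sp4Vec_inj]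
  exact ⟨rfl, rfl, by ring, by ring⟩

theorem ContainsSp4RootElements.exists_smul_eq_of_sp4Form_eq_one [Finite (MaximalSpectrum R)]
    (hH : ContainsSp4RootElements H) {x y : Fin 2 ⊕ Fin 2 → R} (hxy : sp4Form x y = 1) :
    ∃ h ∈ H, h • x = sp4Vec 1 0 0 0 := by
  obtain ⟨a, b, c, d, rfl⟩ := exists_eq_sp4Vec x
  obtain ⟨a', b', c', d', rfl⟩ := exists_eq_sp4Vec y
  rw [sp4Form_vec] at hxy
  obtain ⟨k, hk⟩ := exists_isUnit_add_dotProduct a ![b, c, d] (by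
    intro m ha
    by_contra! h
    have hb := h 0
    have hc := h 1
    have hd := h 2
    apply m.isMaximal.ne_top
    rw [Ideal.eq_top_iff_one, ← hxy]
    exact Ideal.sub_mem _ (Ideal.sub_mem _ (Ideal.add_mem _ (Ideal.mul_mem_right _ _ ha)
      (Ideal.mul_mem_right _ _ hb)) (Ideal.mul_mem_right _ _ hc)) (Ideal.mul_mem_right _ _ hd))
  -- The correction `- k 0 * k 2` cancels the term `k 2 * c` that this element adds to `b` and that
  -- the next root element carries into the first coordinate.
  refine exists_mul_smul_eq (hH.upper (k 1 - k 0 * k 2) (k 2) 0) ?_ (sp4Upper_smul _ _ _ _ _ _ _)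
  refine exists_mul_smul_eq (hH.root (k 0)) ?_ (sp4RootElement_smul _ _ _ _ _)
  apply hH.exists_smul_eq_of_isUnit
  convert hk using 1
  simp [dotProduct, Fin.sum_univ_three]
  ring

/-- Fixing `e₁` and `f₁`, the element `g` acts on the orthogonal plane of `e₂, f₂` with determinant
`1`; `SL₂` over a semilocal ring is elementary, and the elementary matrices used are long root
elements fixing `e₁, f₁`. -/
theorem ContainsSp4RootElements.mem_of_smul_eq [Finite (MaximalSpectrum R)]
    (hH : ContainsSp4RootElements H) {g : Matrix.symplecticGroup (Fin 2) R}
    (h1 : g • sp4Vec (1 : R) 0 0 0 = sp4Vec 1 0 0 0)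
    (h3 : g • sp4Vec (0 : R) 0 1 0 = sp4Vec 0 0 1 0) : g ∈ H := by
  set H' := H ⊓ (MulAction.stabilizer _ (sp4Vec (1 : R) 0 0 0) ⊓
    MulAction.stabilizer _ (sp4Vec (0 : R) 0 1 0)) with hH'
  have hup : ∀ r, sp4Upper 0 0 r ∈ H' := by
    intro r
    refine ⟨hH.upper _ _ _, ?_, ?_⟩ <;>
    · change _ • _ = _
      simp [sp4Upper_smul]
  have hlo : ∀ r, sp4Lower 0 0 r ∈ H' := by
    intro r
    refine ⟨hH.lower _ _ _, ?_, ?_⟩ <;>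
    · change _ • _ = _
      simp [sp4Lower_smul]
  have hg : g ∈ MulAction.stabilizer (Matrix.symplecticGroup (Fin 2) R) (sp4Vec (1 : R) 0 0 0) ⊓
    MulAction.stabilizer _ (sp4Vec (0 : R) 0 1 0) := ⟨h1, h3⟩
  have hshape : ∀ k : Matrix.symplecticGroup (Fin 2) R, k ∈ MulAction.stabilizer
      (Matrix.symplecticGroup (Fin 2) R) (sp4Vec (1 : R) 0 0 0) ⊓
      MulAction.stabilizer _ (sp4Vec (0 : R) 0 1 0) → ∀ s t : R,
      ∃ b d, k • sp4Vec 0 s 0 t = sp4Vec 0 b 0 d := by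
    rintro k ⟨hk1, hk2⟩ s t
    obtain ⟨a, b, c, d, hv⟩ := exists_eq_sp4Vec (k • sp4Vec 0 s 0 t)
    have hc := sp4Form_smul k (sp4Vec 1 0 0 0) (sp4Vec 0 s 0 t)
    -- Orthogonality to `e₁` and `f₁` kills the components along `f₁` and `e₁`.
    have ha := sp4Form_smul k (sp4Vec 0 0 1 0) (sp4Vec 0 s 0 t)
    rw [show k • sp4Vec (1 : R) 0 0 0 = _ from hk1, hv, sp4Form_vec, sp4Form_vec] at hc
    rw [show k • sp4Vec (0 : R) 0 1 0 = _ from hk2, hv, sp4Form_vec, sp4Form_vec] at ha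
    obtain rfl : a = 0 := by linear_combination -ha
    obtain rfl : c = 0 := by linear_combination hc
    exact ⟨b, d, hv⟩
  obtain ⟨b, d, hbd⟩ := hshape g hg 1 0
  obtain ⟨b', d', hbd'⟩ := hshape g hg 0 1
  have hdet := sp4Form_smul g (sp4Vec 0 1 0 0) (sp4Vec 0 0 0 1)
  rw [hbd, hbd', sp4Form_vec, sp4Form_vec] at hdet
  obtain ⟨k, hk⟩ := exists_isUnit_add_dotProduct b ![d] (by
    intro m hb
    by_contra! h
    have hd := h 0
    apply m.isMaximal.ne_top
    rw [Ideal.eq_top_iff_one, show (1 : R) = b * d' - d * b' by linear_combination -hdet]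
    exact Ideal.sub_mem _ (Ideal.mul_mem_right _ _ hb) (Ideal.mul_mem_right _ _ hd))
  obtain ⟨h, hh, hhe⟩ : ∃ h ∈ H', h • sp4Vec 0 b 0 d = sp4Vec 0 1 0 0 := by
    obtain ⟨u, hu⟩ := hk.exists_left_inv
    set e := b + k ⬝ᵥ ![d] with he
    refine exists_mul_smul_eq (hup (k 0)) (w := sp4Vec 0 e 0 d) ?_ ?_
    swap
    · rw [sp4Upper_smul, sp4Vec_inj]
      refine ⟨by ring, ?_, rfl, rfl⟩
      simp [he, dotProduct]
    refine exists_mul_smul_eq (hlo (u - d * u)) (w := sp4Vec 0 e 0 1) ?_ ?_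
    swap
    · rw [sp4Lower_smul, sp4Vec_inj]
      exact ⟨rfl, rfl, by ring, by linear_combination (1 - d) * hu⟩
    refine exists_mul_smul_eq (hup (1 - e)) (w := sp4Vec 0 1 0 1) ?_ ?_
    swap
    · rw [sp4Upper_smul, sp4Vec_inj]
      exact ⟨by ring, by ring, rfl, rfl⟩
    refine ⟨_, hlo (-1), ?_⟩
    rw [sp4Lower_smul, sp4Vec_inj]
    exact ⟨rfl, rfl, by ring, by ring⟩
  have hg' := mul_mem hh.2 hg
  have hhe' : (h * g) • sp4Vec (0 : R) 1 0 0 = sp4Vec 0 1 0 0 := by rw [mul_smul, hbd, hhe]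
  obtain ⟨s, t, hst⟩ := hshape _ hg' 0 1
  have ht := sp4Form_smul (h * g) (sp4Vec 0 1 0 0) (sp4Vec 0 0 0 1)
  rw [hhe', hst, sp4Form_vec, sp4Form_vec] at ht
  obtain rfl : t = 1 := by linear_combination ht
  have hone : sp4Upper 0 0 (-s) * (h * g) = 1 := by
    have hmem := mul_mem (hup (-s)).2 hg'
    refine symplecticGroup_eq_one hmem.1 ?_ hmem.2 ?_
    · rw [mul_smul, hhe', sp4Upper_smul]
      simp
    · rw [mul_smul, hst, sp4Upper_smul]
      simp
  rw [← H.mul_mem_cancel_left hh.1, ← H.mul_mem_cancel_left (hup (-s)).1, hone]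
  exact H.one_mem

/-- Over a semilocal ring, `Sp₄` is generated by its root elements. -/
theorem ContainsSp4RootElements.eq_top [Finite (MaximalSpectrum R)]
    (hH : ContainsSp4RootElements H) : H = ⊤ := by
  rw [eq_top_iff]
  intro g _
  have hform := sp4Form_smul g (sp4Vec 1 0 0 0) (sp4Vec 0 0 1 0)
  rw [sp4Form_vec] at hform
  obtain ⟨h, hh, hhe⟩ := hH.exists_smul_eq_of_sp4Form_eq_one
    (hform.trans (by ring : (1 : R) * 1 + 0 * 0 - 0 * 0 - 0 * 0 = 1))
  rw [← mul_smul] at hhe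
  obtain ⟨p, q, t, r, hv⟩ := exists_eq_sp4Vec ((h * g) • sp4Vec (0 : R) 0 1 0)
  have ht := sp4Form_smul (h * g) (sp4Vec 1 0 0 0) (sp4Vec 0 0 1 0)
  rw [hhe, hv, sp4Form_vec, sp4Form_vec] at ht
  obtain rfl : t = 1 := by linear_combination ht
  -- Root elements fixing `e₁` bring the image `(p, q, 1, r)` of `f₁` back to `f₁`; clearing `r`
  -- first changes `p` to `p + r * q`.
  rw [← H.mul_mem_cancel_left hh, ← H.mul_mem_cancel_left (hH.root r),
    ← H.mul_mem_cancel_left (hH.upper (-(p + r * q)) (-q) 0)]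
  apply hH.mem_of_smul_eq
  · rw [mul_smul, mul_smul, hhe, sp4RootElement_smul, sp4Upper_smul]
    simp
  · rw [mul_smul, mul_smul, hv, sp4RootElement_smul, sp4Upper_smul]
    simp

end SymplecticGeneration

/-! ### The normal closure in `Sp₄`. -/

section SymplecticNormalClosure

variable {R : Type*} [CommRing R]

/-- The rotation `e₂ ↦ f₂`, `f₂ ↦ -e₂` of a hyperbolic plane of `R⁴`. -/
def sp4Rotation : Matrix.symplecticGroup (Fin 2) R :=
  sp4Lower 0 0 1 * sp4Upper 0 0 (-1) * sp4Lower 0 0 1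

/-- The simultaneous exchange of `e₁`, `e₂` and of `f₁`, `f₂`, up to sign. -/
def sp4Exchange : Matrix.symplecticGroup (Fin 2) R :=
  sp4NegRootElement 1 * sp4RootElement (-1) * sp4NegRootElement 1

theorem sp4Rotation_smul (a b c d : R) :
    (sp4Rotation : Matrix.symplecticGroup (Fin 2) R) • sp4Vec a b c d = sp4Vec a (-d) c b := by
  simp only [sp4Rotation, mul_smul, sp4Lower_smul, sp4Upper_smul]
  rw [sp4Vec_inj]
  refine ⟨?_, ?_, ?_, ?_⟩ <;> ring

theorem sp4Exchange_smul (a b c d : R) :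
    (sp4Exchange : Matrix.symplecticGroup (Fin 2) R) • sp4Vec a b c d =
      sp4Vec (-b) a (-d) c := by
  simp only [sp4Exchange, mul_smul, sp4RootElement_smul, sp4NegRootElement_smul]
  rw [sp4Vec_inj]
  refine ⟨?_, ?_, ?_, ?_⟩ <;> ring

theorem symJ_smul (a b c d : R) : SymplecticGroup.symJ (Fin 2) R • sp4Vec a b c d =
    sp4Vec (-c) (-d) a b := by
  rw [symplecticGroup_smul_def]
  simp only [SymplecticGroup.coe_J, Matrix.J, sp4Vec, Matrix.fromBlocks_mulVec]
  ext (i | i) <;> fin_cases i <;> simp [Matrix.neg_mulVec]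

/-- A conjugate `n'` of an element `n` of a normal subgroup lies in it. -/
theorem Subgroup.Normal.mem_of_mul_eq_mul {G : Type*} [Group G] {N : Subgroup G} (hN : N.Normal)
    {n n' : G} (g : G) (hn : n ∈ N) (h : n' * g = g * n) : n' ∈ N := by
  rw [eq_mul_inv_of_mul_eq h]
  exact hN.conj_mem n hn g

theorem sp4Upper_mul (p q r p' q' r' : R) :
    sp4Upper p q r * sp4Upper p' q' r' = sp4Upper (p + p') (q + q') (r + r') := by
  refine symplecticGroup_ext_smul fun a b c d => ?_
  simp only [mul_smul, sp4Upper_smul]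
  rw [sp4Vec_inj]
  refine ⟨?_, ?_, rfl, rfl⟩ <;> ring

theorem sp4Upper_inv (p q r : R) : (sp4Upper p q r)⁻¹ = sp4Upper (-p) (-q) (-r) := by
  rw [inv_eq_iff_mul_eq_one, sp4Upper_mul]
  refine symplecticGroup_ext_smul fun a b c d => ?_
  simp [sp4Upper_smul]

theorem sp4RootElement_mul_sp4Upper (t p q r : R) : sp4RootElement t * sp4Upper p q r =
    sp4Upper (p + 2 * t * q + t ^ 2 * r) (q + t * r) r * sp4RootElement t := by
  refine symplecticGroup_ext_smul fun a b c d => ?_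
  simp only [mul_smul, sp4Upper_smul, sp4RootElement_smul]
  rw [sp4Vec_inj]
  refine ⟨?_, ?_, ?_, ?_⟩ <;> ring

theorem sp4_normalClosure_rootElement_eq_top [Finite (MaximalSpectrum R)]
    (hR : AtMostOneResidueFieldTwo R) {x : R} (hx : IsUnit x) :
    Subgroup.normalClosure {(sp4RootElement x : Matrix.symplecticGroup (Fin 2) R)} = ⊤ := by
  set N := Subgroup.normalClosure {(sp4RootElement x : Matrix.symplecticGroup (Fin 2) R)} with hNdef
  have hN : N.Normal := Subgroup.normalClosure_normal
  obtain ⟨y, hy⟩ := hx.exists_left_inv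
  have hxN : sp4RootElement x ∈ N := Subgroup.subset_normalClosure rfl
  have hcong : ∀ {p q r p' q' r' : R}, sp4Upper p q r ∈ N → p = p' → q = q' → r = r' →
      sp4Upper p' q' r' ∈ N := by
    rintro p q r _ _ _ h rfl rfl rfl
    exact h
  have hmul : ∀ {p q r p' q' r' : R}, sp4Upper p q r ∈ N → sp4Upper p' q' r' ∈ N →
      sp4Upper (p + p') (q + q') (r + r') ∈ N := by
    intro p q r p' q' r' h h'
    rw [← sp4Upper_mul]
    exact N.mul_mem h h'
  have hsub : ∀ {p q r p' q' r' : R}, sp4Upper p q r ∈ N → sp4Upper p' q' r' ∈ N →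
      sp4Upper (p - p') (q - q') (r - r') ∈ N := by
    intro p q r p' q' r' h h'
    have := N.inv_mem h'
    rw [sp4Upper_inv] at this
    exact hcong (hmul h this) (sub_eq_add_neg _ _).symm (sub_eq_add_neg _ _).symm
      (sub_eq_add_neg _ _).symm
  have hconj : ∀ {p q r : R} (t : R), sp4Upper p q r ∈ N →
      sp4Upper (p + 2 * t * q + t ^ 2 * r) (q + t * r) r ∈ N := fun t h =>
    hN.mem_of_mul_eq_mul _ h (sp4RootElement_mul_sp4Upper _ _ _ _).symm
  have hexch : ∀ {p q r : R}, sp4Upper p q r ∈ N → sp4Upper r (-q) p ∈ N := by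
    intro p q r h
    refine hN.mem_of_mul_eq_mul sp4Exchange h (symplecticGroup_ext_smul fun a b c d => ?_)
    simp only [mul_smul, sp4Upper_smul, sp4Exchange_smul]
    rw [sp4Vec_inj]
    refine ⟨?_, ?_, ?_, ?_⟩ <;> ring
  have hrot : ∀ {t : R}, sp4RootElement t ∈ N ↔ sp4Upper 0 (-t) 0 ∈ N := by
    intro t
    constructor
    · intro h
      refine hN.mem_of_mul_eq_mul sp4Rotation⁻¹ h ?_
      rw [mul_inv_eq_iff_eq_mul, mul_assoc, eq_inv_mul_iff_mul_eq]
      refine symplecticGroup_ext_smul fun a b c d => ?_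
      simp only [mul_smul, sp4Upper_smul, sp4RootElement_smul, sp4Rotation_smul]
      rw [sp4Vec_inj]
      refine ⟨?_, ?_, ?_, ?_⟩ <;> ring
    · intro h
      refine hN.mem_of_mul_eq_mul sp4Rotation h (symplecticGroup_ext_smul fun a b c d => ?_)
      simp only [mul_smul, sp4Upper_smul, sp4RootElement_smul, sp4Rotation_smul]
      rw [sp4Vec_inj]
      refine ⟨?_, ?_, ?_, ?_⟩ <;> ring
  have hxU : sp4Upper 0 (-x) 0 ∈ N := hrot.1 hxN
  -- The commutator of the given short root element with a long one: a long factor `x² b` times a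
  -- short factor `x b`.
  have hcomm : ∀ b, sp4Upper (x ^ 2 * b) (x * b) 0 ∈ N := by
    intro b
    have h1 : sp4RootElement x * (sp4Upper 0 0 b * (sp4RootElement x)⁻¹ * (sp4Upper 0 0 b)⁻¹) ∈ N :=
      N.mul_mem hxN (hN.conj_mem _ (N.inv_mem hxN) _)
    rw [← mul_assoc, ← mul_assoc, sp4RootElement_mul_sp4Upper, mul_inv_cancel_right, sp4Upper_inv,
      sp4Upper_mul] at h1
    exact hcong h1 (by ring) (by ring) (by ring)
  -- Exchanging the two long roots negates the short parameter, so the short parts cancel against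
  -- each other.
  have hdiag : ∀ c, sp4Upper c 0 c ∈ N := by
    intro c
    have h1 := hsub (hcomm (y ^ 2 * c)) (hexch (hcomm (-(y ^ 2 * c))))
    have h2 : x ^ 2 * (y ^ 2 * c) = c := by linear_combination c * (x * y + 1) * hy
    exact hcong h1 (by linear_combination h2) (by ring) (by linear_combination h2)
  -- Conjugating `(c, 0, c)` adds `(a² c, a c, 0)`; the commutator with short part `a c` has long
  -- part `x a c`, and the difference is purely long.
  have hlong : ∀ a c, sp4Upper ((a ^ 2 - x * a) * c) 0 0 ∈ N := by
    intro a c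
    have h1 := hsub (hsub (hconj a (hdiag c)) (hdiag c)) (hcomm (y * a * c))
    exact hcong h1 (by linear_combination -x * a * c * hy) (by linear_combination -a * c * hy)
      (by ring)
  -- Scaling by `x²` and replacing `a` by `x * a` turns `a² - x a` into `x² (a² - a)`.
  let A : AddSubgroup R :=
    { carrier := {t | sp4Upper (x ^ 2 * t) 0 0 ∈ N}
      add_mem' := fun {s t} hs ht => hcong (hmul hs ht) (by ring) (by ring) (by ring)
      zero_mem' := hcong (hsub hxU hxU) (by ring) (by ring) (by ring)
      neg_mem' := fun {t} ht => hcong (hsub (hsub ht ht) ht) (by ring) (by ring) (by ring) }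
  have hA : A = ⊤ := by
    refine A.eq_top_of_sq_sub_self_mul_mem hR (fun a c => ?_) isUnit_one ?_
    · exact hcong (hlong (x * a) c) (by ring) rfl rfl
    · exact hcong (hmul (hcomm 1) hxU) (by ring) (by ring) (by ring)
  have h1 : ∀ p, sp4Upper p 0 0 ∈ N := by
    intro p
    have h : y ^ 2 * p ∈ A := hA ▸ AddSubgroup.mem_top _
    exact hcong h (by linear_combination p * (x * y + 1) * hy) rfl rfl
  have h2 : ∀ q, sp4Upper 0 q 0 ∈ N := by
    intro q
    exact hcong (hsub (hcomm (y * q)) (h1 (x ^ 2 * (y * q)))) (by ring)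
      (by linear_combination q * hy) (by ring)
  have h3 : ∀ p q r, sp4Upper p q r ∈ N := by
    intro p q r
    exact hcong (hmul (hmul (h1 p) (h2 q)) (hexch (h1 r))) (by ring) (by ring) (by ring)
  have h4 : ∀ t, sp4RootElement t ∈ N := fun t => hrot.2 (h3 _ _ _)
  refine ContainsSp4RootElements.eq_top ⟨h4, fun t => ?_, h3, fun p q r => ?_⟩
  · refine hN.mem_of_mul_eq_mul sp4Exchange (h4 (-t)) (symplecticGroup_ext_smul fun a b c d => ?_)
    simp only [mul_smul, sp4RootElement_smul, sp4NegRootElement_smul, sp4Exchange_smul]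
    rw [sp4Vec_inj]
    refine ⟨?_, ?_, ?_, ?_⟩ <;> ring
  · refine hN.mem_of_mul_eq_mul (SymplecticGroup.symJ (Fin 2) R) (h3 (-p) (-q) (-r))
      (symplecticGroup_ext_smul fun a b c d => ?_)
    simp only [mul_smul, sp4Upper_smul, sp4Lower_smul, symJ_smul]
    rw [sp4Vec_inj]
    refine ⟨?_, ?_, ?_, ?_⟩ <;> ring

end SymplecticNormalClosure

/-! ### Explicit automorphisms of the split octonions. -/

section GTwoElements

variable {R : Type*}

theorem zorn_ext {x y : Zorn R} (h1 : x.1 = y.1) (h2 : ∀ i, x.2.1 i = y.2.1 i)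
    (h3 : ∀ i, x.2.2.1 i = y.2.2.1 i) (h4 : x.2.2.2 = y.2.2.2) : x = y :=
  Prod.ext h1 (Prod.ext (funext h2) (Prod.ext (funext h3) h4))

theorem forall_fin_three_fun {p : (Fin 3 → R) → Prop} :
    (∀ v, p v) ↔ ∀ a b c, p ![a, b, c] := by
  refine ⟨fun h a b c => h _, fun h v => ?_⟩
  convert h (v 0) (v 1) (v 2)
  ext i
  fin_cases i <;> rfl

variable [CommRing R]

theorem dotProduct_vecThree (a b c a' b' c' : R) :
    ![a, b, c] ⬝ᵥ ![a', b', c'] = a * a' + b * b' + c * c' := by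
  simp [dotProduct, Fin.sum_univ_three]

theorem crossProduct_vecThree (a b c a' b' c' : R) :
    ![a, b, c] ⨯₃ ![a', b', c'] = ![b * c' - c * b', c * a' - a * c', a * b' - b * a'] := by
  simp [cross_apply]

/-- The automorphism of the octonions with given underlying linear map and inverse. -/
def g2OfLinearMap (f f' : Zorn R →ₗ[R] Zorn R) (h : ∀ x, f' (f x) = x) (h' : ∀ x, f (f' x) = x)
    (hmul : ∀ x y, f (zornMul x y) = zornMul (f x) (f y)) : G2 R :=
  ⟨LinearEquiv.ofLinearMap f f' (LinearMap.ext h') (LinearMap.ext h), hmul⟩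

/-- The exponential of the nilpotent derivation of the octonions attached to the vector `u` in the
upper right corner. -/
def g2ShortMap (u : Fin 3 → R) : Zorn R →ₗ[R] Zorn R where
  toFun x := (x.1 + u ⬝ᵥ x.2.2.1, x.2.1 + (x.2.2.2 - x.1) • u - (u ⬝ᵥ x.2.2.1) • u,
    x.2.2.1 + u ⨯₃ x.2.1, x.2.2.2 - u ⬝ᵥ x.2.2.1)
  map_add' x y := by
    refine zorn_ext ?_ (fun i => ?_) (fun i => ?_) ?_ <;> simp <;> ring
  map_smul' c x := by
    refine zorn_ext ?_ (fun i => ?_) (fun i => ?_) ?_ <;> simp <;> ring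

/-- The exponential of the nilpotent derivation of the octonions attached to the vector `u` in the
lower left corner. -/
def g2CoshortMap (u : Fin 3 → R) : Zorn R →ₗ[R] Zorn R where
  toFun x := (x.1 + u ⬝ᵥ x.2.1, x.2.1 + u ⨯₃ x.2.2.1,
    x.2.2.1 + (x.2.2.2 - x.1) • u - (u ⬝ᵥ x.2.1) • u, x.2.2.2 - u ⬝ᵥ x.2.1)
  map_add' x y := by
    refine zorn_ext ?_ (fun i => ?_) (fun i => ?_) ?_ <;> simp <;> ring
  map_smul' c x := by
    refine zorn_ext ?_ (fun i => ?_) (fun i => ?_) ?_ <;> simp <;> ring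

/-- The action of the transvection `v ↦ v + (y ⬝ᵥ v) • u` of `SL₃` on the octonions. -/
def g2LongMap (u y : Fin 3 → R) : Zorn R →ₗ[R] Zorn R where
  toFun x := (x.1, x.2.1 + (y ⬝ᵥ x.2.1) • u, x.2.2.1 - (u ⬝ᵥ x.2.2.1) • y, x.2.2.2)
  map_add' x y := by
    refine zorn_ext ?_ (fun i => ?_) (fun i => ?_) ?_ <;> simp <;> ring
  map_smul' c x := by
    refine zorn_ext ?_ (fun i => ?_) (fun i => ?_) ?_ <;> simp <;> ring

/-- The symmetry of the octonions that exchanges the two idempotents on the diagonal. -/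
def g2SwapMap : Zorn R →ₗ[R] Zorn R where
  toFun x := (x.2.2.2, -x.2.2.1, -x.2.1, x.1)
  map_add' x y := by
    refine zorn_ext ?_ (fun i => ?_) (fun i => ?_) ?_ <;> simp <;> ring
  map_smul' c x := by
    refine zorn_ext ?_ (fun i => ?_) (fun i => ?_) ?_ <;> simp

theorem g2ShortMap_apply (u v w : Fin 3 → R) (a b : R) : g2ShortMap u (a, v, w, b) =
    (a + u ⬝ᵥ w, v + (b - a) • u - (u ⬝ᵥ w) • u, w + u ⨯₃ v, b - u ⬝ᵥ w) := rfl

theorem g2CoshortMap_apply (u v w : Fin 3 → R) (a b : R) : g2CoshortMap u (a, v, w, b) =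
    (a + u ⬝ᵥ v, v + u ⨯₃ w, w + (b - a) • u - (u ⬝ᵥ v) • u, b - u ⬝ᵥ v) := rfl

theorem g2LongMap_apply (u y v w : Fin 3 → R) (a b : R) : g2LongMap u y (a, v, w, b) =
    (a, v + (y ⬝ᵥ v) • u, w - (u ⬝ᵥ w) • y, b) := rfl

theorem g2SwapMap_apply (v w : Fin 3 → R) (a b : R) : g2SwapMap (a, v, w, b) =
    (b, -w, -v, a) := rfl

theorem g2ShortMap_neg (u : Fin 3 → R) (x : Zorn R) : g2ShortMap (-u) (g2ShortMap u x) = x := by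
  obtain ⟨a, v, w, b⟩ := x
  revert u v w
  simp only [forall_fin_three_fun]
  intro u0 u1 u2 v0 v1 v2 w0 w1 w2
  simp only [g2ShortMap_apply, crossProduct_vecThree, dotProduct_vecThree, Matrix.neg_cons,
    Matrix.neg_empty, 
    Matrix.cons_add_cons, Matrix.cons_sub_cons, Matrix.smul_cons, Matrix.smul_empty,
    Matrix.empty_add_empty, Matrix.empty_sub_empty, smul_eq_mul]
  refine zorn_ext ?_ (fun i => ?_) (fun i => ?_) ?_ <;> (try fin_cases i) <;> simp <;> ring

theorem g2ShortMap_zornMul (u : Fin 3 → R) (x y : Zorn R) :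
    g2ShortMap u (zornMul x y) = zornMul (g2ShortMap u x) (g2ShortMap u y) := by
  obtain ⟨a, v, w, b⟩ := x
  obtain ⟨a', v', w', b'⟩ := y
  revert u v w v' w'
  simp only [forall_fin_three_fun]
  intro u0 u1 u2 v0 v1 v2 w0 w1 w2 v0' v1' v2' w0' w1' w2'
  simp only [g2ShortMap_apply, zornMul, crossProduct_vecThree, dotProduct_vecThree,
    Matrix.cons_add_cons, Matrix.cons_sub_cons, Matrix.smul_cons, Matrix.smul_empty,
    Matrix.empty_add_empty, Matrix.empty_sub_empty, smul_eq_mul]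
  refine zorn_ext ?_ (fun i => ?_) (fun i => ?_) ?_ <;> (try fin_cases i) <;> simp <;> ring

theorem g2SwapMap_zornMul (x y : Zorn R) :
    g2SwapMap (zornMul x y) = zornMul (g2SwapMap x) (g2SwapMap y) := by
  obtain ⟨a, v, w, b⟩ := x
  obtain ⟨a', v', w', b'⟩ := y
  revert v w v' w'
  simp only [forall_fin_three_fun]
  intro v0 v1 v2 w0 w1 w2 v0' v1' v2' w0' w1' w2'
  simp only [g2SwapMap_apply, zornMul, crossProduct_vecThree, dotProduct_vecThree, Matrix.neg_cons,
    Matrix.neg_empty, 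
    Matrix.cons_add_cons, Matrix.cons_sub_cons, Matrix.smul_cons, Matrix.smul_empty,
    Matrix.empty_add_empty, Matrix.empty_sub_empty, smul_eq_mul]
  refine zorn_ext ?_ (fun i => ?_) (fun i => ?_) ?_ <;> (try fin_cases i) <;> simp <;> ring

/-- Conjugation by the swap carries every fact about the upper corner to the lower one. -/
theorem g2CoshortMap_eq (u : Fin 3 → R) (x : Zorn R) :
    g2CoshortMap u x = g2SwapMap (g2ShortMap u (g2SwapMap x)) := by
  obtain ⟨a, v, w, b⟩ := x
  revert u v w
  simp only [forall_fin_three_fun]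
  intro u0 u1 u2 v0 v1 v2 w0 w1 w2
  simp only [g2SwapMap_apply, g2ShortMap_apply, g2CoshortMap_apply, crossProduct_vecThree,
    dotProduct_vecThree, Matrix.neg_cons, Matrix.neg_empty, Matrix.cons_add_cons,
    Matrix.cons_sub_cons, Matrix.smul_cons, Matrix.smul_empty, Matrix.empty_add_empty,
    Matrix.empty_sub_empty, smul_eq_mul]
  refine zorn_ext ?_ (fun i => ?_) (fun i => ?_) ?_ <;> (try fin_cases i) <;> simp <;> ring

theorem g2SwapMap_g2SwapMap (x : Zorn R) : g2SwapMap (g2SwapMap x) = x := by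
  obtain ⟨a, v, w, b⟩ := x
  simp [g2SwapMap_apply]

theorem g2LongMap_zornMul {u z : Fin 3 → R} (h : u ⬝ᵥ z = 0) (x y : Zorn R) :
    g2LongMap u z (zornMul x y) = zornMul (g2LongMap u z x) (g2LongMap u z y) := by
  obtain ⟨a, v, w, b⟩ := x
  obtain ⟨a', v', w', b'⟩ := y
  revert u z v w v' w'
  simp only [forall_fin_three_fun]
  intro u0 u1 u2 z0 z1 z2 h v0 v1 v2 w0 w1 w2 v0' v1' v2' w0' w1' w2'
  simp only [g2LongMap_apply, zornMul, crossProduct_vecThree, dotProduct_vecThree,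
    Matrix.cons_add_cons, Matrix.cons_sub_cons, Matrix.smul_cons, Matrix.smul_empty,
    Matrix.empty_add_empty, Matrix.empty_sub_empty, smul_eq_mul] at h ⊢
  refine zorn_ext ?_ (fun i => ?_) (fun i => ?_) ?_ <;> (try fin_cases i) <;> simp
  · linear_combination ((z0*v0+z1*v1+z2*v2)*(u0*w0'+u1*w1'+u2*w2')) * h
  · linear_combination (w1*w2'-w2*w1') * h
  · linear_combination (w2*w0'-w0*w2') * h
  · linear_combination (w0*w1'-w1*w0') * h
  · linear_combination (v1*v2'-v2*v1') * h
  · linear_combination (v2*v0'-v0*v2') * h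
  · linear_combination (v0*v1'-v1*v0') * h
  · linear_combination ((z0*v0'+z1*v1'+z2*v2')*(u0*w0+u1*w1+u2*w2)) * h

theorem g2LongMap_neg {u z : Fin 3 → R} (h : u ⬝ᵥ z = 0) (x : Zorn R) :
    g2LongMap (-u) z (g2LongMap u z x) = x := by
  obtain ⟨a, v, w, b⟩ := x
  have h' : z ⬝ᵥ u = 0 := dotProduct_comm u z ▸ h
  simp [g2LongMap_apply, h, h']

theorem g2CoshortMap_neg (u : Fin 3 → R) (x : Zorn R) :
    g2CoshortMap (-u) (g2CoshortMap u x) = x := by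
  rw [g2CoshortMap_eq, g2CoshortMap_eq, g2SwapMap_g2SwapMap, g2ShortMap_neg, g2SwapMap_g2SwapMap]

/-- The short root type element of `G₂` attached to a vector `u`. -/
def g2Short (u : Fin 3 → R) : G2 R :=
  g2OfLinearMap (g2ShortMap u) (g2ShortMap (-u)) (g2ShortMap_neg u)
    (fun x => by simpa using g2ShortMap_neg (-u) x) (g2ShortMap_zornMul u)

/-- The opposite short root type element of `G₂` attached to a vector `u`. -/
def g2Coshort (u : Fin 3 → R) : G2 R :=
  g2OfLinearMap (g2CoshortMap u) (g2CoshortMap (-u)) (g2CoshortMap_neg u)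
    (fun x => by simpa using g2CoshortMap_neg (-u) x)
    (fun x y => by simp only [g2CoshortMap_eq, g2SwapMap_zornMul, g2ShortMap_zornMul])

/-- The long root type element of `G₂` attached to an orthogonal pair of vectors. -/
def g2Long (u z : Fin 3 → R) (h : u ⬝ᵥ z = 0) : G2 R :=
  g2OfLinearMap (g2LongMap u z) (g2LongMap (-u) z) (g2LongMap_neg h)
    (fun x => by simpa using g2LongMap_neg (u := -u) (by simpa using h) x) (g2LongMap_zornMul h)

/-- The symmetry `g2SwapMap` as an element of `G₂`. -/
def g2Swap : G2 R :=
  g2OfLinearMap g2SwapMap g2SwapMap g2SwapMap_g2SwapMap g2SwapMap_g2SwapMap g2SwapMap_zornMul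

theorem g2Short_smul (u v w : Fin 3 → R) (a b : R) : g2Short u • ((a, v, w, b) : Zorn R) =
    (a + u ⬝ᵥ w, v + (b - a) • u - (u ⬝ᵥ w) • u, w + u ⨯₃ v, b - u ⬝ᵥ w) := rfl

theorem g2Coshort_smul (u v w : Fin 3 → R) (a b : R) : g2Coshort u • ((a, v, w, b) : Zorn R) =
    (a + u ⬝ᵥ v, v + u ⨯₃ w, w + (b - a) • u - (u ⬝ᵥ v) • u, b - u ⬝ᵥ v) := rfl

theorem g2Long_smul (u z v w : Fin 3 → R) (h : u ⬝ᵥ z = 0) (a b : R) :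
    g2Long u z h • ((a, v, w, b) : Zorn R) =
      (a, v + (z ⬝ᵥ v) • u, w - (u ⬝ᵥ w) • z, b) := rfl

theorem g2Swap_smul (v w : Fin 3 → R) (a b : R) :
    (g2Swap : G2 R) • ((a, v, w, b) : Zorn R) = (b, -w, -v, a) := rfl

theorem g2_ext {g h : G2 R} (H : ∀ x : Zorn R, g • x = h • x) : g = h :=
  Subtype.ext (LinearEquiv.ext H)

theorem g2_ext_vecThree {g h : G2 R} (H : ∀ a b v0 v1 v2 w0 w1 w2 : R,
    g • ((a, ![v0, v1, v2], ![w0, w1, w2], b) : Zorn R) =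
      h • ((a, ![v0, v1, v2], ![w0, w1, w2], b) : Zorn R)) : g = h := by
  apply g2_ext
  rintro ⟨a, v, w, b⟩
  revert v w
  simp only [forall_fin_three_fun]
  exact H a b

theorem g2_smul_zornMul (g : G2 R) (x y : Zorn R) :
    g • zornMul x y = zornMul (g • x) (g • y) := g.2 x y

theorem g2RootElement_eq (t : R) : g2RootElement t = g2Short ![t, 0, 0] :=
  g2_ext fun _ => rfl

end GTwoElements

/-! ### Commutator relations in `G₂`. -/

section GTwoRelations

variable {R : Type*} [CommRing R]

theorem g2Coshort_eq (u : Fin 3 → R) : g2Coshort u = g2Swap * g2Short u * g2Swap :=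
  g2_ext (g2CoshortMap_eq u)

theorem g2Swap_mul_self : (g2Swap : G2 R) * g2Swap = 1 :=
  g2_ext g2SwapMap_g2SwapMap

/-- This one identity contains the commutator formulas of the short roots `χᵢ`, `χⱼ`: the cross
product produces the third, opposite short root, and the `SL₃` factor the long roots. The
coefficient `2` is asymmetric in `p` and `q`, so comparing the two orders yields multiples of `3`.
-/
theorem g2Short_mul (p q : Fin 3 → R) : g2Short p * g2Short q =
    g2Short (p + q) * g2Coshort (p ⨯₃ q) * g2Long (p + (2 : R) • q) (p ⨯₃ q) (by simp) := by
  apply g2_ext_vecThree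
  revert p q
  simp only [forall_fin_three_fun]
  intro p0 p1 p2 q0 q1 q2 a b v0 v1 v2 w0 w1 w2
  simp only [mul_smul, g2Short_smul, g2Coshort_smul, g2Long_smul, crossProduct_vecThree,
    dotProduct_vecThree, Matrix.cons_add_cons,
    Matrix.cons_sub_cons, Matrix.smul_cons, Matrix.smul_empty, Matrix.empty_add_empty,
    Matrix.empty_sub_empty, smul_eq_mul]
  refine zorn_ext ?_ (fun i => ?_) (fun i => ?_) ?_ <;> (try fin_cases i) <;> simp <;> ring

theorem g2Swap_mul_g2Long {u z : Fin 3 → R} (h : u ⬝ᵥ z = 0) : g2Swap * g2Long u z h =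
    g2Long (-z) u (by rw [neg_dotProduct, dotProduct_comm, h, neg_zero]) * g2Swap := by
  apply g2_ext
  rintro ⟨a, v, w, b⟩
  simp only [mul_smul, g2Swap_smul, g2Long_smul]
  refine zorn_ext ?_ (fun i => ?_) (fun i => ?_) ?_ <;> simp [mul_comm] <;> ring

theorem g2Coshort_mul (p q : Fin 3 → R) : g2Coshort p * g2Coshort q =
    g2Coshort (p + q) * g2Short (p ⨯₃ q) * g2Long (-(p ⨯₃ q)) (p + (2 : R) • q)
      (by rw [neg_dotProduct, dotProduct_comm, neg_eq_zero]; simp) := by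
  have h2 : ∀ g : G2 R, g2Swap * (g2Swap * g) = g := fun g => by
    rw [← mul_assoc, g2Swap_mul_self, one_mul]
  calc g2Coshort p * g2Coshort q = g2Swap * (g2Short p * g2Short q) * g2Swap := by
        simp only [g2Coshort_eq, mul_assoc, h2]
    _ = g2Coshort (p + q) * g2Short (p ⨯₃ q) *
          (g2Swap * g2Long (p + (2 : R) • q) (p ⨯₃ q) (by simp)) * g2Swap := by
        simp only [g2Short_mul, g2Coshort_eq, mul_assoc]
    _ = _ := by
        simp only [g2Swap_mul_g2Long, mul_assoc, g2Swap_mul_self, mul_one]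

theorem g2Long_mul {u u' z : Fin 3 → R} (h : u ⬝ᵥ z = 0) (h' : u' ⬝ᵥ z = 0) :
    g2Long u z h * g2Long u' z h' =
      g2Long (u + u') z (by rw [add_dotProduct, h, h', add_zero]) := by
  apply g2_ext
  rintro ⟨a, v, w, b⟩
  rw [dotProduct_comm] at h'
  simp only [mul_smul, g2Long_smul, dotProduct_add, dotProduct_smul, dotProduct_sub, h, h']
  refine zorn_ext ?_ (fun i => ?_) (fun i => ?_) ?_ <;> simp <;> ring

theorem g2Long_mul_g2Short {u z : Fin 3 → R} (h : u ⬝ᵥ z = 0) (p : Fin 3 → R) :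
    g2Long u z h * g2Short p = g2Short (p + (z ⬝ᵥ p) • u) * g2Long u z h := by
  apply g2_ext_vecThree
  revert u z p
  simp only [forall_fin_three_fun]
  intro u0 u1 u2 z0 z1 z2 h p0 p1 p2 a b v0 v1 v2 w0 w1 w2
  simp only [mul_smul, g2Short_smul, g2Long_smul, crossProduct_vecThree,
    dotProduct_vecThree, Matrix.cons_add_cons,
    Matrix.cons_sub_cons, Matrix.smul_cons, Matrix.smul_empty, Matrix.empty_add_empty,
    Matrix.empty_sub_empty, smul_eq_mul] at h ⊢
  refine zorn_ext ?_ (fun i => ?_) (fun i => ?_) ?_ <;> (try fin_cases i) <;> simp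
  · linear_combination ((z0*p0+z1*p1+z2*p2)*(u0*w0+u1*w1+u2*w2)) * h
  · linear_combination -((z0*p0+z1*p1+z2*p2)*(u0*w0+u1*w1+u2*w2)*(p0+(z0*p0+z1*p1+z2*p2)*u0)) * h
  · linear_combination -((z0*p0+z1*p1+z2*p2)*(u0*w0+u1*w1+u2*w2)*(p1+(z0*p0+z1*p1+z2*p2)*u1)) * h
  · linear_combination -((z0*p0+z1*p1+z2*p2)*(u0*w0+u1*w1+u2*w2)*(p2+(z0*p0+z1*p1+z2*p2)*u2)) * h
  · linear_combination -(p1*v2-p2*v1) * h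
  · linear_combination -(p2*v0-p0*v2) * h
  · linear_combination -(p0*v1-p1*v0) * h
  · linear_combination ((z0*p0+z1*p1+z2*p2)*(u0*w0+u1*w1+u2*w2)) * h

theorem g2Long_mul_g2Long {u z u' z' : Fin 3 → R} (h : u ⬝ᵥ z = 0) (h' : u' ⬝ᵥ z' = 0) :
    g2Long u z h * g2Long u' z' h' = g2Long (u' + (z ⬝ᵥ u') • u) (z' - (u ⬝ᵥ z') • z)
      (by simp [h, h', dotProduct_comm z u']; ring) * g2Long u z h := by
  apply g2_ext_vecThree
  intro a b v0 v1 v2 w0 w1 w2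
  simp only [mul_smul, g2Long_smul]
  revert u z u' z'
  simp only [forall_fin_three_fun]
  intro u0 u1 u2 z0 z1 z2 x0 x1 x2 y0 y1 y2 h h'
  simp only [dotProduct_vecThree, Matrix.cons_add_cons,
    Matrix.cons_sub_cons, Matrix.smul_cons, Matrix.smul_empty, Matrix.empty_add_empty,
    Matrix.empty_sub_empty, smul_eq_mul] at h h' ⊢
  refine zorn_ext rfl (fun i => ?_) (fun i => ?_) rfl <;> fin_cases i <;> simp
  · linear_combination ((u0*y0+u1*y1+u2*y2)*(z0*v0+z1*v1+z2*v2)*(x0+(z0*x0+z1*x1+z2*x2)*u0)) * h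
  · linear_combination ((u0*y0+u1*y1+u2*y2)*(z0*v0+z1*v1+z2*v2)*(x1+(z0*x0+z1*x1+z2*x2)*u1)) * h
  · linear_combination ((u0*y0+u1*y1+u2*y2)*(z0*v0+z1*v1+z2*v2)*(x2+(z0*x0+z1*x1+z2*x2)*u2)) * h
  · linear_combination -((z0*x0+z1*x1+z2*x2)*(u0*w0+u1*w1+u2*w2)*(y0-(u0*y0+u1*y1+u2*y2)*z0)) * h
  · linear_combination -((z0*x0+z1*x1+z2*x2)*(u0*w0+u1*w1+u2*w2)*(y1-(u0*y0+u1*y1+u2*y2)*z1)) * h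
  · linear_combination -((z0*x0+z1*x1+z2*x2)*(u0*w0+u1*w1+u2*w2)*(y2-(u0*y0+u1*y1+u2*y2)*z2)) * h

theorem g2Long_mul_right {u z z' : Fin 3 → R} (h : u ⬝ᵥ z = 0) (h' : u ⬝ᵥ z' = 0) :
    g2Long u z h * g2Long u z' h' =
      g2Long u (z + z') (by rw [dotProduct_add, h, h', add_zero]) := by
  apply g2_ext
  rintro ⟨a, v, w, b⟩
  have h2 : z ⬝ᵥ u = 0 := dotProduct_comm u z ▸ h
  simp only [mul_smul, g2Long_smul, dotProduct_add, dotProduct_smul, dotProduct_sub, h', h2]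
  refine zorn_ext ?_ (fun i => ?_) (fun i => ?_) ?_ <;> simp [add_dotProduct] <;> ring

/-- The short roots `χ₁` and `-χ₂` add up to the long root `χ₁ - χ₂`, with structure constant `±3`.
-/
theorem g2Short_mul_g2Coshort (a b : R) : g2Short ![a, 0, 0] * g2Coshort ![0, b, 0] =
    g2Long ![-3 * a * b, 0, 0] ![0, 1, 0] (by simp) * g2Coshort ![0, b, 0] *
      g2Short ![a, 0, 0] := by
  apply g2_ext_vecThree
  intro a b v0 v1 v2 w0 w1 w2
  simp only [mul_smul, g2Short_smul, g2Coshort_smul, g2Long_smul, crossProduct_vecThree,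
    dotProduct_vecThree, Matrix.cons_add_cons,
    Matrix.cons_sub_cons, Matrix.smul_cons, Matrix.smul_empty, Matrix.empty_add_empty,
    Matrix.empty_sub_empty, smul_eq_mul]
  refine zorn_ext ?_ (fun i => ?_) (fun i => ?_) ?_ <;> (try fin_cases i) <;> simp <;> ring

theorem g2Short_zero : g2Short (0 : Fin 3 → R) = 1 := by
  apply g2_ext
  rintro ⟨a, v, w, b⟩
  simp [g2Short_smul]

theorem g2Coshort_zero : g2Coshort (0 : Fin 3 → R) = 1 := by
  apply g2_ext
  rintro ⟨a, v, w, b⟩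
  simp [g2Coshort_smul]

theorem g2Long_zero_right (u : Fin 3 → R) : g2Long u 0 (dotProduct_zero u) = 1 := by
  apply g2_ext
  rintro ⟨a, v, w, b⟩
  simp [g2Long_smul]

theorem g2Long_congr {u z u' z' : Fin 3 → R} (h : u ⬝ᵥ z = 0) (hu : u = u') (hz : z = z') :
    g2Long u z h = g2Long u' z' (hu ▸ hz ▸ h) := by
  subst hu hz
  rfl

theorem g2Short_mul_of_cross_eq_zero {p q : Fin 3 → R} (h : p ⨯₃ q = 0) :
    g2Short p * g2Short q = g2Short (p + q) := by
  rw [g2Short_mul, g2Long_congr _ rfl h, g2Long_zero_right, h, g2Coshort_zero, mul_one, mul_one]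

theorem g2Coshort_mul_of_cross_eq_zero {p q : Fin 3 → R} (h : p ⨯₃ q = 0) :
    g2Coshort p * g2Coshort q = g2Coshort (p + q) := by
  have h2 : ∀ g : G2 R, g2Swap * (g2Swap * g) = g := fun g => by
    rw [← mul_assoc, g2Swap_mul_self, one_mul]
  rw [g2Coshort_eq, g2Coshort_eq, g2Coshort_eq, ← g2Short_mul_of_cross_eq_zero h]
  simp only [mul_assoc, h2]

theorem g2Short_inv (p : Fin 3 → R) : (g2Short p)⁻¹ = g2Short (-p) := by
  rw [inv_eq_iff_mul_eq_one, g2Short_mul_of_cross_eq_zero (by simp), add_neg_cancel, g2Short_zero]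

theorem g2Coshort_inv (p : Fin 3 → R) : (g2Coshort p)⁻¹ = g2Coshort (-p) := by
  rw [inv_eq_iff_mul_eq_one, g2Coshort_mul_of_cross_eq_zero (by simp), add_neg_cancel,
    g2Coshort_zero]

theorem g2Long_inv {u z : Fin 3 → R} (h : u ⬝ᵥ z = 0) :
    (g2Long u z h)⁻¹ = g2Long u (-z) (by rw [dotProduct_neg, h, neg_zero]) := by
  rw [inv_eq_iff_mul_eq_one, g2Long_mul_right, g2Long_congr _ rfl (add_neg_cancel z),
    g2Long_zero_right]

end GTwoRelations

/-! ### The stabilizer of the diagonal idempotent is `SL₃`, generated by transvections. -/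

section GTwoGeneration

variable {R : Type*} [CommRing R]

theorem single_dotProduct_single_of_ne {i j : Fin 3} (h : i ≠ j) (s t : R) :
    (Pi.single i s : Fin 3 → R) ⬝ᵥ Pi.single j t = 0 := by
  simp [h]

/-- A subgroup of `G₂(R)` that contains all root elements. -/
structure ContainsG2RootElements (H : Subgroup (G2 R)) : Prop where
  short : ∀ i t, g2Short (Pi.single i t) ∈ H
  coshort : ∀ i t, g2Coshort (Pi.single i t) ∈ H
  long : ∀ (i j : Fin 3) (t : R) (h : i ≠ j),
    g2Long (Pi.single i t) (Pi.single j 1) (single_dotProduct_single_of_ne h t 1) ∈ H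

/-- The octonion with upper right corner `v` and zeros elsewhere. -/
def zornUpper (v : Fin 3 → R) : Zorn R := (0, v, 0, 0)

/-- The octonion with lower left corner `w` and zeros elsewhere. -/
def zornLower (w : Fin 3 → R) : Zorn R := (0, 0, w, 0)

/-- The idempotent in the upper left corner of the octonions. -/
def zornIdem (R : Type*) [CommRing R] : Zorn R := (1, 0, 0, 0)

theorem g2_smul_smul (g : G2 R) (c : R) (x : Zorn R) : g • (c • x) = c • (g • x) :=
  g.1.map_smul c x

theorem g2_smul_add (g : G2 R) (x y : Zorn R) : g • (x + y) = g • x + g • y :=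
  g.1.map_add x y

theorem g2_smul_one (g : G2 R) : g • ((1, 0, 0, 1) : Zorn R) = (1, 0, 0, 1) := by
  have hl : ∀ x : Zorn R, zornMul (1, 0, 0, 1) x = x := fun x => by simp [zornMul]
  have hr : ∀ x : Zorn R, zornMul x (1, 0, 0, 1) = x := fun x => by simp [zornMul]
  have h := g2_smul_zornMul g (1, 0, 0, 1) (g⁻¹ • ((1, 0, 0, 1) : Zorn R))
  rw [hl, smul_inv_smul, hr] at h
  exact h.symm

/-- The upper corner is the Peirce space `e x = x`, `x e = 0` of the fixed idempotent `e`; the lower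
corner below is the one with the sides exchanged. -/
theorem g2_smul_zornUpper {g : G2 R} (hg : g • zornIdem R = zornIdem R) (v : Fin 3 → R) :
    ∃ v', g • zornUpper v = zornUpper v' := by
  rcases hy : g • zornUpper v with ⟨a, v', w', b⟩
  have h1 := g2_smul_zornMul g (zornIdem R) (zornUpper v)
  have h2 := g2_smul_zornMul g (zornUpper v) (zornIdem R)
  rw [show zornMul (zornIdem R) (zornUpper v) = zornUpper v by simp [zornMul, zornIdem, zornUpper],
    hg, hy] at h1
  rw [show zornMul (zornUpper v) (zornIdem R) = (0 : R) • zornUpper v by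
    simp [zornMul, zornIdem, zornUpper], g2_smul_smul, hg, hy] at h2
  simp [zornMul, zornIdem] at h1 h2
  have h3 : (0 : R) = a := congrArg Prod.fst h2
  exact ⟨v', by rw [h1.1, h1.2, ← h3]; rfl⟩

theorem g2_smul_zornLower {g : G2 R} (hg : g • zornIdem R = zornIdem R) (w : Fin 3 → R) :
    ∃ w', g • zornLower w = zornLower w' := by
  rcases hy : g • zornLower w with ⟨a, v', w', b⟩
  have h1 := g2_smul_zornMul g (zornLower w) (zornIdem R)
  have h2 := g2_smul_zornMul g (zornIdem R) (zornLower w)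
  rw [show zornMul (zornLower w) (zornIdem R) = zornLower w by simp [zornMul, zornIdem, zornLower],
    hg, hy] at h1
  rw [show zornMul (zornIdem R) (zornLower w) = (0 : R) • zornLower w by
    simp [zornMul, zornIdem, zornLower], g2_smul_smul, hg, hy] at h2
  simp [zornMul, zornIdem] at h1 h2
  have h3 : (0 : R) = a := congrArg Prod.fst h2
  exact ⟨w', by rw [h1.1, h1.2, ← h3]; rfl⟩

theorem dotProduct_eq_of_g2_smul {g : G2 R} (hg : g • zornIdem R = zornIdem R)
    {v w v' w' : Fin 3 → R} (hv : g • zornUpper v = zornUpper v')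
    (hw : g • zornLower w = zornLower w') : v' ⬝ᵥ w' = v ⬝ᵥ w := by
  have h : ∀ v w : Fin 3 → R, zornMul (zornUpper v) (zornLower w) = (v ⬝ᵥ w) • zornIdem R :=
    fun v w => by simp [zornMul, zornIdem, zornLower, zornUpper]
  have h1 := g2_smul_zornMul g (zornUpper v) (zornLower w)
  rw [h, g2_smul_smul, hg, hv, hw, h] at h1
  simpa [zornIdem] using (congrArg Prod.fst h1).symm

theorem g2_smul_zornLower_cross {g : G2 R} {v w v' w' : Fin 3 → R}
    (hv : g • zornUpper v = zornUpper v')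
    (hw : g • zornUpper w = zornUpper w') : g • zornLower (v ⨯₃ w) = zornLower (v' ⨯₃ w') := by
  have h : ∀ v w : Fin 3 → R, (-1 : R) • zornMul (zornUpper v) (zornUpper w) =
      zornLower (v ⨯₃ w) := fun v w => by simp [zornMul, zornLower, zornUpper]
  rw [← h, ← h, g2_smul_smul, g2_smul_zornMul, hv, hw]

theorem g2Long_smul_zornUpper {u z : Fin 3 → R} (h : u ⬝ᵥ z = 0) (v : Fin 3 → R) :
    g2Long u z h • zornUpper v = zornUpper (v + (z ⬝ᵥ v) • u) := by
  simp [zornUpper, g2Long_smul]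

theorem g2Long_smul_zornIdem {u z : Fin 3 → R} (h : u ⬝ᵥ z = 0) :
    g2Long u z h • zornIdem R = zornIdem R := by
  simp [zornIdem, g2Long_smul]

/-- The idempotent, the unit and the upper corner determine an automorphism, since products within
the upper corner fill the lower one. -/
theorem g2_eq_one {g : G2 R} (he : g • zornIdem R = zornIdem R)
    (h0 : g • zornUpper (![1, 0, 0] : Fin 3 → R) = zornUpper ![1, 0, 0])
    (h1 : g • zornUpper (![0, 1, 0] : Fin 3 → R) = zornUpper ![0, 1, 0])
    (h2 : g • zornUpper (![0, 0, 1] : Fin 3 → R) = zornUpper ![0, 0, 1]) : g = 1 := by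
  have k0 := g2_smul_zornLower_cross h1 h2
  have k1 := g2_smul_zornLower_cross h2 h0
  have k2 := g2_smul_zornLower_cross h0 h1
  have hf := g2_smul_one g
  apply g2_ext_vecThree
  intro a b v0 v1 v2 w0 w1 w2
  have hlin : ((a, ![v0, v1, v2], ![w0, w1, w2], b) : Zorn R) =
      (a - b) • zornIdem R + b • ((1, 0, 0, 1) : Zorn R) +
      v0 • zornUpper ![1, 0, 0] + v1 • zornUpper ![0, 1, 0] + v2 • zornUpper ![0, 0, 1] +
      w0 • zornLower (![0, 1, 0] ⨯₃ ![0, 0, 1]) + w1 • zornLower (![0, 0, 1] ⨯₃ ![1, 0, 0]) +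
      w2 • zornLower (![1, 0, 0] ⨯₃ ![0, 1, 0]) := by
    refine zorn_ext ?_ (fun i => ?_) (fun i => ?_) ?_ <;> (try fin_cases i) <;>
      simp [zornIdem, zornUpper, zornLower, crossProduct_vecThree]
  rw [hlin]
  simp only [g2_smul_add, g2_smul_smul, he, hf, h0, h1, h2, k0, k1, k2, one_smul]

theorem exists_smul_zornUpper_eq {H : Subgroup (G2 R)} {i j : Fin 3} {t : R} (hij : i ≠ j)
    {v v' : Fin 3 → R} {x : Zorn R}
    (hH : ∀ h : i ≠ j,
      g2Long (Pi.single i t) (Pi.single j 1) (single_dotProduct_single_of_ne h t 1) ∈ H)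
    (h : ∃ h ∈ H, h • zornUpper v' = x) (hv : v + Pi.single i (t * v j) = v') :
    ∃ h ∈ H, h • zornUpper v = x := by
  refine exists_mul_smul_eq (hH hij) h ?_
  rw [g2Long_smul_zornUpper, ← hv, single_dotProduct, one_mul, ← Pi.single_smul', smul_eq_mul,
    mul_comm]

theorem vecThree_add_single_zero (a b c t : R) :
    ![a, b, c] + Pi.single 0 t = ![a + t, b, c] := by
  ext i; fin_cases i <;> simp

theorem vecThree_add_single_one (a b c t : R) :
    ![a, b, c] + Pi.single 1 t = ![a, b + t, c] := by
  ext i; fin_cases i <;> simp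

theorem vecThree_add_single_two (a b c t : R) :
    ![a, b, c] + Pi.single 2 t = ![a, b, c + t] := by
  ext i; fin_cases i <;> simp

variable {H : Subgroup (G2 R)}

theorem exists_smul_zornUpper_eq_first [Finite (MaximalSpectrum R)]
    (hH : ∀ (i j : Fin 3) (t : R) (h : i ≠ j),
      g2Long (Pi.single i t) (Pi.single j 1) (single_dotProduct_single_of_ne h t 1) ∈ H)
    {v w : Fin 3 → R} (hvw : v ⬝ᵥ w = 1) :
    ∃ h ∈ H, h • zornUpper v = zornUpper ![1, 0, 0] := by
  revert v w
  simp only [forall_fin_three_fun, dotProduct_vecThree]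
  intro a b c a' b' c' hvw
  obtain ⟨k, hk⟩ := exists_isUnit_add_dotProduct a ![b, c] (by
    intro m ha
    by_contra! h
    have hb := h 0
    have hc := h 1
    apply m.isMaximal.ne_top
    rw [Ideal.eq_top_iff_one, ← hvw]
    exact Ideal.add_mem _ (Ideal.add_mem _ (Ideal.mul_mem_right _ _ ha)
      (Ideal.mul_mem_right _ _ hb)) (Ideal.mul_mem_right _ _ hc))
  set e := a + k ⬝ᵥ ![b, c] with he
  have he' : a + k 0 * b + k 1 * c = e := by
    simp [he, dotProduct, Fin.sum_univ_two]
    ring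
  obtain ⟨u, hu⟩ := hk.exists_left_inv
  refine exists_smul_zornUpper_eq (i := 0) (j := 1) (t := k 0) (by decide) (hH _ _ _) ?_
    (vecThree_add_single_zero _ _ _ _)
  refine exists_smul_zornUpper_eq (i := 0) (j := 2) (t := k 1) (by decide) (hH _ _ _) ?_
    (vecThree_add_single_zero _ _ _ _)
  refine exists_smul_zornUpper_eq (i := 1) (j := 0) (t := u - b * u) (v' := ![e, 1, c]) (by decide)
    (hH _ _ _) ?_ ?_
  swap
  · rw [vecThree_add_single_one]
    simp only [Matrix.cons_val_one, Matrix.cons_val_zero, Matrix.cons_val]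
    rw [he', show b + (u - b * u) * e = 1 by linear_combination (1 - b) * hu]
  refine exists_smul_zornUpper_eq (i := 0) (j := 1) (t := 1 - e) (v' := ![1, 1, c]) (by decide)
    (hH _ _ _) ?_ (by rw [vecThree_add_single_zero]; simp)
  refine exists_smul_zornUpper_eq (i := 1) (j := 0) (t := -1) (v' := ![1, 0, c]) (by decide)
    (hH _ _ _) ?_ (by rw [vecThree_add_single_one]; simp)
  refine exists_smul_zornUpper_eq (i := 2) (j := 0) (t := -c) (v' := ![1, 0, 0]) (by decide)
    (hH _ _ _) ?_ (by rw [vecThree_add_single_two]; simp)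
  exact ⟨1, H.one_mem, one_smul _ _⟩

theorem exists_smul_zornUpper_eq_second [Finite (MaximalSpectrum R)]
    (hH : ∀ (i j : Fin 3) (t : R) (h : i ≠ j), j ≠ 0 →
      g2Long (Pi.single i t) (Pi.single j 1) (single_dotProduct_single_of_ne h t 1) ∈ H)
    {a b c b' c' : R} (hvw : b * b' + c * c' = 1) :
    ∃ h ∈ H, h • zornUpper ![a, b, c] = zornUpper ![0, 1, 0] := by
  obtain ⟨k, hk⟩ := exists_isUnit_add_dotProduct b ![c] (by
    intro m hb
    by_contra! h
    have hc := h 0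
    apply m.isMaximal.ne_top
    rw [Ideal.eq_top_iff_one, ← hvw]
    exact Ideal.add_mem _ (Ideal.mul_mem_right _ _ hb) (Ideal.mul_mem_right _ _ hc))
  set e := b + k ⬝ᵥ ![c] with he
  have he' : b + k 0 * c = e := by
    simp [he, dotProduct]
  obtain ⟨u, hu⟩ := hk.exists_left_inv
  refine exists_smul_zornUpper_eq (i := 1) (j := 2) (t := k 0) (by decide)
    (fun h => hH _ _ _ h (by decide)) ?_ (vecThree_add_single_one _ _ _ _)
  refine exists_smul_zornUpper_eq (i := 2) (j := 1) (t := u - c * u) (v' := ![a, e, 1]) (by decide)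
    (fun h => hH _ _ _ h (by decide)) ?_ ?_
  swap
  · rw [vecThree_add_single_two]
    simp only [Matrix.cons_val_one, Matrix.cons_val_zero, Matrix.cons_val]
    rw [he', show c + (u - c * u) * e = 1 by linear_combination (1 - c) * hu]
  refine exists_smul_zornUpper_eq (i := 1) (j := 2) (t := 1 - e) (v' := ![a, 1, 1]) (by decide)
    (fun h => hH _ _ _ h (by decide)) ?_ (by rw [vecThree_add_single_one]; simp)
  refine exists_smul_zornUpper_eq (i := 2) (j := 1) (t := -1) (v' := ![a, 1, 0]) (by decide)
    (fun h => hH _ _ _ h (by decide)) ?_ (by rw [vecThree_add_single_two]; simp)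
  refine exists_smul_zornUpper_eq (i := 0) (j := 1) (t := -a) (v' := ![0, 1, 0]) (by decide)
    (fun h => hH _ _ _ h (by decide)) ?_ (by rw [vecThree_add_single_zero]; simp)
  exact ⟨1, H.one_mem, one_smul _ _⟩

/-- Such a `g` acts on the upper corner by a `3 × 3` matrix and dually on the lower one. Its columns
are reduced to the standard basis one at a time; no determinant is computed, because the dual action
and the cross product supply the needed equations. -/
theorem ContainsG2RootElements.mem_of_smul_zornIdem_eq [Finite (MaximalSpectrum R)]
    (hH : ContainsG2RootElements H) {g : G2 R} (hg : g • zornIdem R = zornIdem R) : g ∈ H := by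
  have hfix : ∀ (i j : Fin 3) (t : R) (h : i ≠ j) (v : Fin 3 → R), v j = 0 →
      g2Long (Pi.single i t) (Pi.single j 1) (single_dotProduct_single_of_ne h t 1) • zornUpper v =
        zornUpper v := fun i j t h v hv => by simp [g2Long_smul_zornUpper, hv]
  set S := MulAction.stabilizer (G2 R) (zornIdem R)
  set S0 := MulAction.stabilizer (G2 R) (zornUpper (![1, 0, 0] : Fin 3 → R))
  set S1 := MulAction.stabilizer (G2 R) (zornUpper (![0, 1, 0] : Fin 3 → R))
  obtain ⟨v, hv⟩ := g2_smul_zornUpper hg ![1, 0, 0]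
  obtain ⟨w, hw⟩ := g2_smul_zornLower hg ![1, 0, 0]
  have hvw := dotProduct_eq_of_g2_smul hg hv hw
  obtain ⟨h, hh, hhv⟩ := exists_smul_zornUpper_eq_first (H := H ⊓ S)
    (fun i j t hij => ⟨hH.long i j t hij, g2Long_smul_zornIdem _⟩)
    (hvw.trans (by simp))
  rw [← H.mul_mem_cancel_left hh.1]
  replace hg : (h * g) • zornIdem R = zornIdem R := by rw [mul_smul, hg]; exact hh.2
  rw [← hv, ← mul_smul] at hhv
  generalize h * g = g at hg hhv ⊢
  clear hvw hv hw hh h v w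
  obtain ⟨v, hv⟩ := g2_smul_zornUpper hg ![0, 1, 0]
  obtain ⟨w, hw⟩ := g2_smul_zornLower hg ![0, 1, 0]
  have hvw := dotProduct_eq_of_g2_smul hg hv hw
  -- The dual vector has first coordinate `0`, so the last two coordinates of `v` are already
  -- unimodular, and transvections fixing the first basis vector suffice.
  have hvw' := dotProduct_eq_of_g2_smul hg hhv hw
  obtain ⟨h, hh, hhv'⟩ : ∃ h ∈ H ⊓ (S ⊓ S0), h • zornUpper v = zornUpper ![0, 1, 0] := by
    revert v w
    simp only [forall_fin_three_fun, dotProduct_vecThree]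
    intro a b c _ a' b' c' _ hvw hvw'
    refine exists_smul_zornUpper_eq_second (H := H ⊓ (S ⊓ S0)) (b' := b') (c' := c')
      (fun i j t hij hj => ⟨hH.long i j t hij, g2Long_smul_zornIdem _, hfix i j t hij _ ?_⟩) ?_
    · fin_cases j <;> simp_all
    · linear_combination hvw - a * hvw'
  rw [← H.mul_mem_cancel_left hh.1]
  replace hg : (h * g) • zornIdem R = zornIdem R := by rw [mul_smul, hg]; exact hh.2.1
  replace hhv : (h * g) • zornUpper ![(1 : R), 0, 0] = zornUpper ![1, 0, 0] := by
    rw [mul_smul, hhv]; exact hh.2.2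
  rw [← hv, ← mul_smul] at hhv'
  generalize h * g = g at hg hhv hhv' ⊢
  clear hvw hvw' hv hw hh h v w
  -- The cross product of the two fixed columns is fixed, which forces the last entry of the third
  -- column to be `1`.
  have hcross := g2_smul_zornLower_cross hhv hhv'
  obtain ⟨v, hv⟩ := g2_smul_zornUpper hg ![0, 0, 1]
  have hvw := dotProduct_eq_of_g2_smul hg hv hcross
  obtain ⟨h, hh, hhv''⟩ : ∃ h ∈ H ⊓ (S ⊓ (S0 ⊓ S1)), h • zornUpper v = zornUpper ![0, 0, 1] := by
    revert v
    simp only [forall_fin_three_fun, dotProduct_vecThree, crossProduct_vecThree]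
    intro a b c _ hvw
    obtain rfl : c = 1 := by linear_combination hvw
    have hmem : ∀ (i : Fin 3) (t : R) (h : i ≠ 2),
        g2Long (Pi.single i t) (Pi.single 2 1) (single_dotProduct_single_of_ne h t 1) ∈
          H ⊓ (S ⊓ (S0 ⊓ S1)) := fun i t h => ⟨hH.long i 2 t h, g2Long_smul_zornIdem _,
      hfix i 2 t h _ rfl, hfix i 2 t h _ rfl⟩
    refine exists_smul_zornUpper_eq (i := 0) (j := 2) (t := -a) (v' := ![0, b, 1]) (by decide)
      (hmem _ _) ?_ (by rw [vecThree_add_single_zero]; simp)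
    refine exists_smul_zornUpper_eq (i := 1) (j := 2) (t := -b) (v' := ![0, 0, 1]) (by decide)
      (hmem _ _) ?_ (by rw [vecThree_add_single_one]; simp)
    exact ⟨1, Subgroup.one_mem _, one_smul _ _⟩
  rw [← H.mul_mem_cancel_left hh.1]
  convert H.one_mem
  apply g2_eq_one
  · rw [mul_smul, hg]; exact hh.2.1
  · rw [mul_smul, hhv]; exact hh.2.2.1
  · rw [mul_smul, hhv']; exact hh.2.2.2
  · rw [mul_smul, hv, hhv'']

theorem ContainsG2RootElements.g2Long_mem [Finite (MaximalSpectrum R)]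
    (hH : ContainsG2RootElements H) {u z : Fin 3 → R} (h : u ⬝ᵥ z = 0) : g2Long u z h ∈ H :=
  hH.mem_of_smul_zornIdem_eq (g2Long_smul_zornIdem h)

theorem ContainsG2RootElements.g2Short_add_mem [Finite (MaximalSpectrum R)]
    (hH : ContainsG2RootElements H) {p q : Fin 3 → R} (hp : g2Short p ∈ H) (hq : g2Short q ∈ H)
    (hpq : g2Coshort (p ⨯₃ q) ∈ H) : g2Short (p + q) ∈ H := by
  have h := g2Short_mul p q
  rw [mul_assoc, ← mul_inv_eq_iff_eq_mul] at h
  rw [← h]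
  exact H.mul_mem (H.mul_mem hp hq) (H.inv_mem (H.mul_mem hpq (hH.g2Long_mem _)))

theorem ContainsG2RootElements.g2Coshort_add_mem [Finite (MaximalSpectrum R)]
    (hH : ContainsG2RootElements H) {p q : Fin 3 → R} (hp : g2Coshort p ∈ H)
    (hq : g2Coshort q ∈ H) (hpq : g2Short (p ⨯₃ q) ∈ H) : g2Coshort (p + q) ∈ H := by
  have h := g2Coshort_mul p q
  rw [mul_assoc, ← mul_inv_eq_iff_eq_mul] at h
  rw [← h]
  exact H.mul_mem (H.mul_mem hp hq) (H.inv_mem (H.mul_mem hpq (hH.g2Long_mem _)))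

theorem single_zero_eq (a : R) : (Pi.single 0 a : Fin 3 → R) = ![a, 0, 0] := by
  ext i; fin_cases i <;> simp

theorem single_one_eq (a : R) : (Pi.single 1 a : Fin 3 → R) = ![0, a, 0] := by
  ext i; fin_cases i <;> simp

theorem single_two_eq (a : R) : (Pi.single 2 a : Fin 3 → R) = ![0, 0, a] := by
  ext i; fin_cases i <;> simp

/-- Coordinates are added one at a time. The error terms of `g2Short_mul` are a transvection,
already in `H`, and an opposite element whose vector has fewer non-zero coordinates. -/
theorem ContainsG2RootElements.g2Short_mem_and_g2Coshort_mem [Finite (MaximalSpectrum R)]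
    (hH : ContainsG2RootElements H) (u : Fin 3 → R) : g2Short u ∈ H ∧ g2Coshort u ∈ H := by
  have hs0 := hH.short 0
  have hs1 := hH.short 1
  have hs2 := hH.short 2
  have hc0 := hH.coshort 0
  have hc1 := hH.coshort 1
  have hc2 := hH.coshort 2
  simp only [single_zero_eq, single_one_eq, single_two_eq] at hs0 hs1 hs2 hc0 hc1 hc2
  have hs : ∀ b c, g2Short ![0, b, c] ∈ H := by
    intro b c
    have h := hH.g2Short_add_mem (hs1 b) (hs2 c) (by
      rw [crossProduct_vecThree]; simpa using hc0 (b * c))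
    simpa using h
  have hc : ∀ b c, g2Coshort ![0, b, c] ∈ H := by
    intro b c
    have h := hH.g2Coshort_add_mem (hc1 b) (hc2 c) (by
      rw [crossProduct_vecThree]; simpa using hs0 (b * c))
    simpa using h
  revert u
  rw [forall_fin_three_fun]
  intro a b c
  constructor
  · have h := hH.g2Short_add_mem (hs0 a) (hs b c) (by
      rw [crossProduct_vecThree]; simpa using hc (-(a * c)) (a * b))
    simpa using h
  · have h := hH.g2Coshort_add_mem (hc0 a) (hc b c) (by
      rw [crossProduct_vecThree]; simpa using hs (-(a * c)) (a * b))
    simpa using h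

end GTwoGeneration

/-! ### The orbit of the diagonal idempotent. -/

section GTwoTransitivity

variable {R : Type*} [CommRing R]

/-- The image of the idempotent in the upper left corner under an automorphism has trace `1` and
norm `0`. -/
theorem g2_smul_zornIdem {g : G2 R} {a b : R} {v w : Fin 3 → R}
    (hg : g • zornIdem R = (a, v, w, b)) : a + b = 1 ∧ a * b = v ⬝ᵥ w := by
  have h1 := g2_smul_zornMul g (zornIdem R) (zornIdem R)
  rw [show zornMul (zornIdem R) (zornIdem R) = zornIdem R by simp [zornMul, zornIdem], hg] at h1
  have ha : a = a * a + v ⬝ᵥ w := congrArg Prod.fst h1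
  have hb : b = b * b + w ⬝ᵥ v := congrArg (fun x => x.2.2.2) h1
  have hv : ∀ i, (a + b - 1) * v i = 0 := by
    intro i
    have h := congrArg (fun x : Zorn R => x.2.1 i) h1
    simp [zornMul] at h
    linear_combination -h
  have hw : ∀ i, (a + b - 1) * w i = 0 := by
    intro i
    have h := congrArg (fun x : Zorn R => x.2.2.1 i) h1
    simp [zornMul] at h
    linear_combination -h
  rw [dotProduct_comm w v] at hb
  -- Idempotency makes `a + b - 1` times the image a scalar octonion. Pulling back by `g`, the same
  -- multiple of `(1, 0, 0, 0)` is scalar, hence zero.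
  have hscal : g • ((a + b - 1) • zornIdem R) =
      g • (((a + b - 1) * a) • ((1, 0, 0, 1) : Zorn R)) := by
    rw [g2_smul_smul, g2_smul_smul, hg, g2_smul_one]
    refine zorn_ext ?_ (fun i => ?_) (fun i => ?_) ?_
    · simp
    · simpa using hv i
    · simpa using hw i
    · simp
      linear_combination ha - hb
  have h2 := MulAction.injective g hscal
  have h3 : (a + b - 1) * 1 = (a + b - 1) * a * 1 := congrArg Prod.fst h2
  have h4 : (a + b - 1) * 0 = (a + b - 1) * a * 1 := congrArg (fun x => x.2.2.2) h2
  have h5 : a + b = 1 := by linear_combination h3 - h4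
  exact ⟨h5, by linear_combination ha + a * h5⟩

/-- The first factor yields `(1, v, 0, 0)`; the second creates `w`, and trace `1` with norm `0`
makes the diagonal come out as `a` and `b`. -/
theorem g2_orbit_parametrization {u a b : R} {v w : Fin 3 → R} (hu : u * a = 1) (hab : a + b = 1)
    (hvw : a * b = v ⬝ᵥ w) :
    g2Coshort (-(u • w)) • g2Short (-v) • zornIdem R = (a, v, w, b) := by
  have hd : w ⬝ᵥ v = a * b := by rw [dotProduct_comm, hvw]
  simp only [zornIdem, g2Short_smul, g2Coshort_smul]
  refine zorn_ext ?_ (fun i => ?_) (fun i => ?_) ?_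
  · simp [hd]
    linear_combination -hab - b * hu
  · simp
  · simp [hd]
    linear_combination w i * hu - u * w i * (hab + b * hu)
  · simp [hd]
    linear_combination b * hu

end GTwoTransitivity

/-! ### Generation of `G₂` over a semilocal ring by root elements. -/

section GTwoGeneration

variable {R : Type*} [CommRing R] {H : Subgroup (G2 R)}

/-- Where `a`, `v`, `w` all vanish modulo `m`, one has `b ≡ 1`, and `t ≡ 1` puts a `1` into the
first entry of `v`; elsewhere `t ≡ 0` changes nothing. -/
theorem exists_g2Short_smul_forall_notMem [Finite (MaximalSpectrum R)] {a b : R}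
    {v w : Fin 3 → R} (hab : a + b = 1) :
    ∃ (t a' : R) (v' w' : Fin 3 → R) (b' : R),
      g2Short ![t, 0, 0] • ((a, v, w, b) : Zorn R) = (a', v', w', b') ∧
      ∀ m : MaximalSpectrum R, a' ∈ m.asIdeal → (∀ i, w' i ∈ m.asIdeal) →
        ∃ i, v' i ∉ m.asIdeal := by
  classical
  revert v w
  simp only [forall_fin_three_fun]
  intro v0 v1 v2 w0 w1 w2
  obtain ⟨t, ht⟩ := exists_sub_mem_maximalSpectrum fun m : MaximalSpectrum R =>
    if a ∈ m.asIdeal ∧ v0 ∈ m.asIdeal ∧ v1 ∈ m.asIdeal ∧ v2 ∈ m.asIdeal ∧ w0 ∈ m.asIdeal ∧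
      w1 ∈ m.asIdeal ∧ w2 ∈ m.asIdeal then 1 else 0
  refine ⟨t, _, _, _, _, g2Short_smul _ _ _ _ _, fun m ha hw => ?_⟩
  by_contra! hv
  have := m.isMaximal.isPrime
  have hv0 := hv 0
  have hv1 := hv 1
  have hv2 := hv 2
  have hw0 := hw 0
  have hw1 := hw 1
  have hw2 := hw 2
  have htm := ht m
  simp only [dotProduct_vecThree, crossProduct_vecThree] at ha hv0 hv1 hv2 hw0 hw1 hw2
  simp only [← Ideal.Quotient.eq_zero_iff_mem] at *
  simp at ha hv0 hv1 hv2 hw0 hw1 hw2 htm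
  set π := Ideal.Quotient.mk m.asIdeal
  have hab' : π a + π b = 1 := by rw [← map_add, hab, map_one]
  split_ifs at htm with hc
  · obtain ⟨ca, c0, c1, c2, d0, d1, d2⟩ := hc
    rw [sub_eq_zero.1 htm, ca, c0, d0] at hv0
    simp at hv0
    rw [ca, hv0, add_zero] at hab'
    exact zero_ne_one hab'
  · rw [sub_zero] at htm
    rw [htm] at ha hv0 hw1 hw2
    simp at ha hv0 hw1 hw2
    exact hc ⟨ha, hv0, hv1, hv2, hw0, hw1, hw2⟩

/-- Where `a` and `w` vanish modulo `m`, a basis vector `y` moves a non-zero entry of `v` into `a`;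
elsewhere `y ≡ 0`. Afterwards `a` and `w` are jointly unimodular, ready for stable range one. -/
theorem exists_g2Coshort_smul_forall_notMem [Finite (MaximalSpectrum R)] {a b : R}
    {v w : Fin 3 → R} (h : ∀ m : MaximalSpectrum R, a ∈ m.asIdeal → (∀ i, w i ∈ m.asIdeal) →
        ∃ i, v i ∉ m.asIdeal) :
    ∃ (y : Fin 3 → R) (a' : R) (v' w' : Fin 3 → R) (b' : R),
      g2Coshort y • ((a, v, w, b) : Zorn R) = (a', v', w', b') ∧
      ∀ m : MaximalSpectrum R, a' ∈ m.asIdeal → ∃ i, w' i ∉ m.asIdeal := by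
  classical
  have key : ∀ m : MaximalSpectrum R, ∃ y : Fin 3 → R,
      (a ∈ m.asIdeal ∧ (∀ i, w i ∈ m.asIdeal) ∧ ∃ i, v i ∉ m.asIdeal ∧ y = Pi.single i 1) ∨
      (¬ (a ∈ m.asIdeal ∧ ∀ i, w i ∈ m.asIdeal) ∧ y = 0) := by
    intro m
    by_cases hc : a ∈ m.asIdeal ∧ ∀ i, w i ∈ m.asIdeal
    · obtain ⟨i, hi⟩ := h m hc.1 hc.2
      exact ⟨_, Or.inl ⟨hc.1, hc.2, i, hi, rfl⟩⟩
    · exact ⟨_, Or.inr ⟨hc, rfl⟩⟩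
  choose f hf using key
  obtain ⟨y, hy⟩ := exists_sub_mem_maximalSpectrum_pi f
  refine ⟨y, _, _, _, _, g2Coshort_smul _ _ _ _ _, fun m ha => ?_⟩
  by_contra! hw
  have hym : (y - f m) ⬝ᵥ v ∈ m.asIdeal :=
    m.asIdeal.sum_mem fun i _ => m.asIdeal.mul_mem_right _ (hy m i)
  rw [sub_dotProduct] at hym
  rcases hf m with ⟨ham, -, i, hi, hfm⟩ | ⟨hne, hfm⟩
  · rw [hfm, single_dotProduct, one_mul] at hym
    apply hi
    have h1 := m.asIdeal.sub_mem (m.asIdeal.sub_mem ha ham) hym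
    rwa [show a + y ⬝ᵥ v - a - (y ⬝ᵥ v - v i) = v i by ring] at h1
  · rw [hfm, zero_dotProduct, sub_zero] at hym
    refine hne ⟨(m.asIdeal.add_mem_iff_left hym).1 ha, fun i => ?_⟩
    have hyi : y i ∈ m.asIdeal := by simpa [hfm] using hy m i
    have h1 := hw i
    simp only [Pi.add_apply, Pi.sub_apply, Pi.smul_apply, smul_eq_mul] at h1
    have h2 := (m.asIdeal.sub_mem_iff_left (m.asIdeal.mul_mem_left _ hyi)).1 h1
    exact (m.asIdeal.add_mem_iff_left (m.asIdeal.mul_mem_left _ hyi)).1 h2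

theorem exists_isUnit_fst_smul [Finite (MaximalSpectrum R)] (g : G2 R) :
    ∃ (c y : Fin 3 → R) (t : R),
      IsUnit ((g2Short c * (g2Coshort y * (g2Short ![t, 0, 0] * g))) • zornIdem R).1 := by
  rcases h0 : g • zornIdem R with ⟨a0, v0, w0, b0⟩
  obtain ⟨t, a1, v1, w1, b1, h1, hm1⟩ := exists_g2Short_smul_forall_notMem (v := v0) (w := w0)
    (g2_smul_zornIdem h0).1
  obtain ⟨y, a2, v2, w2, b2, h2, hm2⟩ := exists_g2Coshort_smul_forall_notMem (b := b1) hm1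
  obtain ⟨c, hunit⟩ := exists_isUnit_add_dotProduct a2 w2 hm2
  refine ⟨c, y, t, ?_⟩
  rw [mul_smul, mul_smul, mul_smul, h0, h1, h2, g2Short_smul]
  exact hunit

theorem ContainsG2RootElements.mem_of_isUnit_fst_smul [Finite (MaximalSpectrum R)]
    (hH : ContainsG2RootElements H) {g : G2 R} (hg : IsUnit (g • zornIdem R).1) : g ∈ H := by
  rcases h : g • zornIdem R with ⟨a, v, w, b⟩
  rw [h] at hg
  obtain ⟨u, hu⟩ := hg.exists_left_inv
  obtain ⟨htr, hnorm⟩ := g2_smul_zornIdem h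
  have hk := (g2_orbit_parametrization hu htr hnorm).trans h.symm
  rw [← mul_smul] at hk
  have hkH : g2Coshort (-(u • w)) * g2Short (-v) ∈ H :=
    H.mul_mem (hH.g2Short_mem_and_g2Coshort_mem _).2 (hH.g2Short_mem_and_g2Coshort_mem _).1
  generalize g2Coshort (-(u • w)) * g2Short (-v) = k at hk hkH
  rw [← H.mul_mem_cancel_left (H.inv_mem hkH)]
  apply hH.mem_of_smul_zornIdem_eq
  rw [mul_smul, ← hk, inv_smul_smul]

/-- Over a semilocal ring, `G₂` is generated by its root elements. -/
theorem ContainsG2RootElements.eq_top [Finite (MaximalSpectrum R)]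
    (hH : ContainsG2RootElements H) : H = ⊤ := by
  rw [eq_top_iff]
  intro g _
  obtain ⟨c, y, t, h⟩ := exists_isUnit_fst_smul g
  have h' := hH.mem_of_isUnit_fst_smul h
  have hs := fun u => (hH.g2Short_mem_and_g2Coshort_mem u).1
  rwa [H.mul_mem_cancel_left (hs _),
    H.mul_mem_cancel_left (hH.g2Short_mem_and_g2Coshort_mem _).2,
    H.mul_mem_cancel_left (hs _)] at h'

end GTwoGeneration

/-! ### The normal closure in `G₂`. -/

section GTwoNormalSubgroups

variable {R : Type*} [CommRing R] {N : Subgroup (G2 R)}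

theorem g2Long_smul_right {u z : Fin 3 → R} (c : R) (h : u ⬝ᵥ z = 0) :
    g2Long u (c • z) (by rw [dotProduct_smul, h, smul_zero]) =
      g2Long (c • u) z (by rw [smul_dotProduct, h, smul_zero]) := by
  apply g2_ext
  rintro ⟨a, v, w, b⟩
  simp only [g2Long_smul, smul_dotProduct, smul_smul, smul_eq_mul, mul_comm]

theorem Subgroup.Normal.g2Short_add_mem (hN : N.Normal) {p u z : Fin 3 → R} (h : u ⬝ᵥ z = 0)
    (hp : g2Short p ∈ N) : g2Short (p + (z ⬝ᵥ p) • u) ∈ N :=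
  hN.mem_of_mul_eq_mul _ hp (g2Long_mul_g2Short h p).symm

theorem Subgroup.Normal.g2Short_single_mem (hN : N.Normal) {i j : Fin 3} (hij : i ≠ j) {t : R}
    (h : g2Short (Pi.single i t) ∈ N) : g2Short (Pi.single j t) ∈ N := by
  have h1 := hN.g2Short_add_mem (u := Pi.single j 1) (z := Pi.single i 1)
    (single_dotProduct_single_of_ne hij.symm 1 1) h
  have h2 := hN.g2Short_add_mem (u := Pi.single i (-1)) (z := Pi.single j 1)
    (single_dotProduct_single_of_ne hij (-1) 1) h1
  convert h2 using 2
  ext k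
  simp [Pi.single_apply, hij]
  split_ifs <;> simp_all

theorem Subgroup.Normal.g2Short_mem_iff_g2Coshort_mem (hN : N.Normal) {u : Fin 3 → R} :
    g2Short u ∈ N ↔ g2Coshort u ∈ N := by
  have h : g2Coshort u * g2Swap = g2Swap * g2Short u := by
    rw [g2Coshort_eq, mul_assoc, g2Swap_mul_self, mul_one]
  refine ⟨fun hu => hN.mem_of_mul_eq_mul g2Swap hu h, fun hu => ?_⟩
  refine hN.mem_of_mul_eq_mul g2Swap hu ?_
  rw [g2Coshort_eq]
  simp only [← mul_assoc, g2Swap_mul_self, one_mul]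

theorem g2Long_mem_of_add_mem {u u' z : Fin 3 → R} (h : u ⬝ᵥ z = 0) (h' : u' ⬝ᵥ z = 0)
    (hu : g2Long u z h ∈ N)
    (huu' : g2Long (u + u') z (by rw [add_dotProduct, h, h', add_zero]) ∈ N) :
    g2Long u' z h' ∈ N := by
  rwa [← g2Long_mul h h', N.mul_mem_cancel_left hu] at huu'

theorem Subgroup.Normal.g2Long_conj_mem (hN : N.Normal) {u z u' z' : Fin 3 → R} (h : u ⬝ᵥ z = 0)
    (h' : u' ⬝ᵥ z' = 0) (hmem : g2Long u' z' h' ∈ N) :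
    g2Long (u' + (z ⬝ᵥ u') • u) (z' - (u ⬝ᵥ z') • z)
      (by simp [h, h', dotProduct_comm z u']; ring) ∈ N :=
  hN.mem_of_mul_eq_mul _ hmem (g2Long_mul_g2Long h h').symm

/-- Membership of the long root elements `1 + t e_{ij}` in a subgroup. -/
def ContainsG2Long (N : Subgroup (G2 R)) (i j : Fin 3) (t : R) : Prop :=
  ∀ h : i ≠ j, g2Long (Pi.single i t) (Pi.single j 1) (single_dotProduct_single_of_ne h t 1) ∈ N

/-- Conjugating `1 + t e_{ij}` by `1 + e_{ki}` multiplies it by `1 + t e_{kj}`. With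
`ContainsG2Long.move_right` this reaches every long root. -/
theorem ContainsG2Long.move_left (hN : N.Normal) {i j k : Fin 3} {t : R} (hij : i ≠ j)
    (hik : i ≠ k) (h : ContainsG2Long N i j t) : ContainsG2Long N k j t := by
  intro hkj
  have h1 := hN.g2Long_conj_mem (single_dotProduct_single_of_ne hik.symm 1 1) _ (h hij)
  refine g2Long_mem_of_add_mem _ _ (h hij) ?_
  convert h1 using 2
  · congr 1
    ext l
    simp [Pi.single_apply]
  · simp [hkj]

theorem ContainsG2Long.move_right (hN : N.Normal) {i j k : Fin 3} {t : R} (hij : i ≠ j)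
    (hjk : j ≠ k) (h : ContainsG2Long N i j t) : ContainsG2Long N i k t := by
  intro hik
  have h1 := hN.g2Long_conj_mem (single_dotProduct_single_of_ne hjk 1 1) _ (h hij)
  have h2 : g2Long (Pi.single i t) (Pi.single j 1 + -Pi.single k 1)
      (by simp [hij, hik]) ∈ N := by
    convert h1 using 2
    · simp [hik.symm]
    · simp [sub_eq_add_neg]
  rw [← g2Long_mul_right (single_dotProduct_single_of_ne hij t 1) (by simp [hik]),
    N.mul_mem_cancel_left (h hij), ← g2Long_inv (single_dotProduct_single_of_ne hik t 1)] at h2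
  exact inv_mem_iff.1 h2

theorem ContainsG2Long.of_one_two (hN : N.Normal) {t : R} (h : ContainsG2Long N 1 2 t)
    (i j : Fin 3) : ContainsG2Long N i j t := by
  have h02 := h.move_left hN (k := 0) (by decide) (by decide)
  have h01 := h02.move_right hN (k := 1) (by decide) (by decide)
  have h21 := h01.move_left hN (k := 2) (by decide) (by decide)
  have h20 := h21.move_right hN (k := 0) (by decide) (by decide)
  have h10 := h20.move_left hN (k := 1) (by decide) (by decide)
  intro hij
  fin_cases i <;> fin_cases j <;> first | exact absurd rfl hij | skip
  exacts [h01 hij, h02 hij, h10 hij, h hij, h20 hij, h21 hij]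

theorem g2Long_third_mem {a b : R} (ha : ContainsG2Long N 0 2 a) (hb : ContainsG2Long N 1 2 b) :
    g2Long ![a, b, 0] ![0, 0, 1] (by simp) ∈ N := by
  have h := N.mul_mem (ha (by decide)) (hb (by decide))
  rw [g2Long_mul] at h
  convert h using 2
  · simp [single_zero_eq, single_one_eq]
  · rw [single_two_eq]

theorem g2Long_third_smul (a b c : R) : g2Long ![a, b, 0] ![0, 0, c] (by simp) =
    g2Long ![c * a, c * b, 0] ![0, 0, 1] (by simp) := by
  have h := g2Long_smul_right (u := ![a, b, 0]) (z := ![0, 0, 1]) c (by simp)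
  convert h using 2 <;> simp

theorem g2Short_mul_first_second (a b : R) : g2Short ![a, 0, 0] * g2Short ![0, b, 0] =
    g2Short ![a, b, 0] * g2Coshort ![0, 0, a * b] *
      g2Long ![a * b * a, a * b * (2 * b), 0] ![0, 0, 1] (by simp) := by
  rw [g2Short_mul, ← g2Long_third_smul]
  congr 1
  · simp [crossProduct_vecThree]
  · apply g2Long_congr <;> simp [crossProduct_vecThree]

theorem g2Short_mul_second_first (a b : R) : g2Short ![0, b, 0] * g2Short ![a, 0, 0] =
    g2Short ![a, b, 0] * g2Coshort ![0, 0, -(a * b)] *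
      g2Long ![-(a * b) * (2 * a), -(a * b) * b, 0] ![0, 0, 1] (by simp) := by
  rw [g2Short_mul, ← g2Long_third_smul]
  congr 1
  · simp [crossProduct_vecThree, mul_comm]
  · apply g2Long_congr <;> simp [crossProduct_vecThree, mul_comm]

theorem g2Short_first_second_mem (hN : N.Normal) {x y : R} (hy : y * x = 1)
    (hx : g2Short ![x, 0, 0] ∈ N) (c : R) : g2Short ![x, c, 0] ∈ N := by
  have h := hN.g2Short_add_mem (u := ![0, y * c, 0]) (z := ![1, 0, 0]) (by simp) hx
  convert h using 2
  simp
  linear_combination -c * hy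

theorem containsG2Long_three_mul (hN : N.Normal) {x y : R} (hy : y * x = 1)
    (hx : g2Short ![x, 0, 0] ∈ N) (i j : Fin 3) (t : R) : ContainsG2Long N i j (3 * t) := by
  have h01 : ContainsG2Long N 0 1 (3 * t) := by
    intro _
    have h := g2Short_mul_g2Coshort x (-(y * t))
    rw [mul_assoc, ← mul_inv_eq_iff_eq_mul, mul_inv_rev, ← mul_assoc] at h
    have hmem : g2Long ![-3 * x * -(y * t), 0, 0] ![0, 1, 0] (by simp) ∈ N := by
      rw [← h, mul_assoc (g2Short _), mul_assoc (g2Short _)]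
      exact N.mul_mem hx (hN.conj_mem _ (N.inv_mem hx) _)
    convert hmem using 2
    · rw [single_zero_eq, show -3 * x * -(y * t) = 3 * t by linear_combination 3 * t * hy]
    · rw [single_one_eq]
  have h02 := h01.move_right hN (k := 2) (by decide) (by decide)
  exact (h02.move_left hN (k := 1) (by decide) (by decide)).of_one_two hN i j

/-- Modulo `N`, the two orders of multiplying the elements of `x e₁` and `d e₂` express one element
through the opposite elements of `c e₃` and `-c e₃`. The long factors differ by parameters divisible
by `3`, which are trivial modulo `N`, so parameter `2c` is trivial too. -/
theorem g2Short_two_mul_mem (hN : N.Normal) {x y : R} (hy : y * x = 1)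
    (hx : g2Short ![x, 0, 0] ∈ N) (c : R) : g2Short ![0, 2 * c, 0] ∈ N := by
  suffices h : g2Coshort ![0, 0, 2 * c] ∈ N by
    rw [← hN.g2Short_mem_iff_g2Coshort_mem, ← single_two_eq] at h
    rw [← single_one_eq]
    exact hN.g2Short_single_mem (by decide) h
  let π := QuotientGroup.mk' N
  have hπ : ∀ g : G2 R, π g = 1 ↔ g ∈ N := fun g => QuotientGroup.eq_one_iff g
  set d := y * c with hd
  have hxd : x * d = c := by linear_combination c * hy
  have h1 := congrArg π (g2Short_mul_first_second x d)
  have h2 := congrArg π (g2Short_mul_second_first x d)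
  have hE := (hπ _).2 (g2Short_first_second_mem hN hy hx d)
  have hx' := (hπ _).2 hx
  rw [hxd] at h1 h2
  simp only [map_mul, hx', hE, one_mul, mul_one] at h1 h2
  rw [h1, show ![(0 : R), 0, -c] = -![0, 0, c] by simp, ← g2Coshort_inv, map_inv,
    eq_inv_mul_iff_mul_eq, ← mul_assoc, ← map_mul, g2Coshort_mul_of_cross_eq_zero (by simp),
    ← eq_mul_inv_iff_mul_eq, ← map_inv, g2Long_inv, ← map_mul] at h2
  rw [← hπ, show ![(0 : R), 0, 2 * c] = ![0, 0, c] + ![0, 0, c] by simp [two_mul], h2, hπ]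
  have h3 := g2Long_third_mem (containsG2Long_three_mul hN hy hx 0 2 (-(c * x)))
    (containsG2Long_three_mul hN hy hx 1 2 (-(c * d)))
  convert h3 using 1
  rw [g2Long_congr (z := -![0, 0, 1]) (z' := ![0, 0, -1]) _ rfl (by simp),
    g2Long_third_smul _ _ (-1), g2Long_mul]
  apply g2Long_congr
  · simp
    constructor <;> ring
  · rfl

theorem containsG2Long_of_isUnit (hN : N.Normal) {x y : R} (hy : y * x = 1)
    (hx : g2Short ![x, 0, 0] ∈ N) (i j : Fin 3) (t : R) : ContainsG2Long N i j t := by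
  -- With `2c` in place of `c` all short factors of the product formula lie in `N`, hence so does
  -- the long one.
  have hmem : ∀ c, g2Long ![x * (2 * c) * x, x * (2 * c) * (2 * (2 * c)), 0] ![0, 0, 1] (by simp)
      ∈ N := by
    intro c
    have h := g2Short_mul_first_second x (2 * c)
    have hF : g2Coshort ![0, 0, x * (2 * c)] ∈ N := by
      rw [← hN.g2Short_mem_iff_g2Coshort_mem, ← single_two_eq]
      refine hN.g2Short_single_mem (i := 1) (by decide) ?_
      rw [single_one_eq, show x * (2 * c) = 2 * (x * c) by ring]
      exact g2Short_two_mul_mem hN hy hx _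
    have hl := N.mul_mem hx (g2Short_two_mul_mem hN hy hx c)
    rwa [h, N.mul_mem_cancel_left
      (N.mul_mem (g2Short_first_second_mem hN hy hx _) hF)] at hl
  have htwo : ∀ t, ContainsG2Long N 1 2 (2 * t) := by
    intro t _
    have h1 := hmem (y ^ 2 * t)
    -- This conjugation adds the first coordinate to the second; dividing isolates the linear term
    -- `2t` from the quadratic one. Then `t = 3t - 2t`.
    have h2 := hN.g2Long_conj_mem (u := ![0, 1, 0]) (z := ![1, 0, 0]) (by simp) _ h1
    refine g2Long_mem_of_add_mem (u := ![x * (2 * (y ^ 2 * t)) * x,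
      x * (2 * (y ^ 2 * t)) * (2 * (2 * (y ^ 2 * t))), 0]) (by simp [single_two_eq]) _ ?_ ?_
    · convert h1 using 2
      rw [single_two_eq]
    · convert h2 using 2
      · rw [single_one_eq]
        simp
        linear_combination -2 * t * (x * y + 1) * hy
      · rw [single_two_eq]
        simp
  refine ContainsG2Long.of_one_two hN (fun h => ?_) i j
  have h3 := containsG2Long_three_mul hN hy hx 1 2 t h
  refine g2Long_mem_of_add_mem _ _ (htwo t h) ?_
  convert h3 using 2
  rw [← Pi.single_add]
  ring_nf

theorem g2_normalClosure_rootElement_eq_top [Finite (MaximalSpectrum R)]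
    (hR : AtMostOneResidueFieldTwo R) {x : R} (hx : IsUnit x) :
    Subgroup.normalClosure {(g2RootElement x : G2 R)} = ⊤ := by
  set N := Subgroup.normalClosure {(g2RootElement x : G2 R)} with hNdef
  have hN : N.Normal := Subgroup.normalClosure_normal
  obtain ⟨y, hy⟩ := hx.exists_left_inv
  have hxN : g2Short ![x, 0, 0] ∈ N := g2RootElement_eq x ▸ Subgroup.subset_normalClosure rfl
  have hlong := containsG2Long_of_isUnit hN hy hxN
  let π := QuotientGroup.mk' N
  have hπ : ∀ g : G2 R, π g = 1 ↔ g ∈ N := fun g => QuotientGroup.eq_one_iff g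
  -- Modulo long root elements, the elements of `(a, a c, 0)` and `(a, 0, 0)` agree, being conjugate
  -- under one, and cancel from the product formula. Comparing `a` with `1` gives equal classes for
  -- parameters `a c` and `a² c`.
  have key : ∀ a c, π (g2Short ![0, a * c, 0]) = π (g2Coshort ![0, 0, a ^ 2 * c]) := by
    intro a c
    have h1 := congrArg π (g2Short_mul_first_second a (a * c))
    have h2 := congrArg π (g2Long_mul_g2Short (u := ![0, c, 0]) (z := ![1, 0, 0]) (by simp)
      ![a, 0, 0])
    have hl : g2Long ![0, c, 0] ![1, 0, 0] (by simp) ∈ N := by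
      have h := hlong 1 0 c (by decide)
      simpa only [single_one_eq, single_zero_eq] using h
    have hl2 := g2Long_third_mem (hlong 0 2 (a * (a * c) * a))
      (hlong 1 2 (a * (a * c) * (2 * (a * c))))
    rw [← hπ] at hl hl2
    rw [map_mul, map_mul, hl, one_mul, mul_one] at h2
    rw [map_mul, map_mul, map_mul, hl2, mul_one, h2,
      show ![a, 0, 0] + (![1, 0, 0] ⬝ᵥ ![a, 0, 0]) • ![0, c, 0] = ![a, a * c, 0] by simp,
      mul_left_cancel_iff] at h1
    rw [h1, show a * (a * c) = a ^ 2 * c by ring]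
  have hadd : ∀ s t : R, g2Short ![0, s, 0] * g2Short ![0, t, 0] = g2Short ![0, s + t, 0] := by
    intro s t
    rw [g2Short_mul_of_cross_eq_zero (by simp [crossProduct_vecThree])]
    simp
  let A : AddSubgroup R :=
    { carrier := {t | g2Short ![0, t, 0] ∈ N}
      add_mem' := fun {s t} hs ht => by
        change _ ∈ N
        rw [← hadd]
        exact N.mul_mem hs ht
      zero_mem' := by
        have h : g2Short ![(0 : R), 0, 0] = 1 := by
          rw [← single_zero_eq, Pi.single_zero, g2Short_zero]
        change g2Short ![(0 : R), 0, 0] ∈ N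
        rw [h]
        exact N.one_mem
      neg_mem' := fun {t} ht => by
        have h := N.inv_mem ht
        rw [g2Short_inv] at h
        simpa using h }
  have hA : A = ⊤ := by
    refine A.eq_top_of_sq_sub_self_mul_mem hR (fun a c => ?_) hx ?_
    · change g2Short ![0, (a ^ 2 - a) * c, 0] ∈ N
      have h1 := key a c
      have h2 := key 1 (a ^ 2 * c)
      rw [one_pow, one_mul, ← h1] at h2
      rw [show (a ^ 2 - a) * c = a ^ 2 * c + -(a * c) by ring, ← hadd, ← hπ, map_mul, h2, ← map_mul,
        hadd, add_neg_cancel, hπ]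
      exact A.zero_mem
    · change g2Short ![0, x, 0] ∈ N
      rw [← single_one_eq]
      rw [← single_zero_eq] at hxN
      exact hN.g2Short_single_mem (by decide) hxN
  have hs : ∀ i t, g2Short (Pi.single i t) ∈ N := by
    intro i t
    have ht : t ∈ A := hA ▸ AddSubgroup.mem_top t
    change g2Short ![0, t, 0] ∈ N at ht
    rw [← single_one_eq] at ht
    by_cases hi : 1 = i
    · exact hi ▸ ht
    · exact hN.g2Short_single_mem hi ht
  exact ContainsG2RootElements.eq_top
    ⟨hs, fun i t => hN.g2Short_mem_iff_g2Coshort_mem.1 (hs i t), fun i j t h => hlong i j t h⟩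

end GTwoNormalSubgroups

/-- `S` lists only the non-archimedean places, since archimedean ones impose no integrality
condition. The residue field hypothesis compares ideals rather than indices, so a prime may be
repeated in the family. -/
theorem mainTheorem12 {K : Type*} [Field K] [NumberField K]
    (S : Set (IsDedekindDomain.HeightOneSpectrum (NumberField.RingOfIntegers K)))
    (hS : S.Finite)
    (s : ℕ) (P : Fin s → Ideal (S.integer K)) (l : Fin s → ℕ)
    (hprime : ∀ i, (P i).IsPrime) (hne : ∀ i, P i ≠ ⊥)
    (htwo : ∀ i j, Nonempty ((S.integer K ⧸ P i) ≃+* ZMod 2) →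
      Nonempty ((S.integer K ⧸ P j) ≃+* ZMod 2) → P i = P j)
    (x : S.integer K ⧸ ∏ i, P i ^ l i) (hx : IsUnit x) :
    Subgroup.normalClosure {sp4RootElement x} = ⊤ ∧
      Subgroup.normalClosure {g2RootElement x} = ⊤ := by
  have hmax : ∀ i, (P i).IsMaximal := fun i =>
    have := hprime i
    isMaximal_of_isPrime_integer S (P i) (hne i)
  have hfin := finite_maximalSpectrum_quotient_prod P l hmax
  have htwo' := atMostOneResidueFieldTwo_quotient_prod P l hmax htwo
  exact ⟨sp4_normalClosure_rootElement_eq_top htwo' hx,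
    g2_normalClosure_rootElement_eq_top htwo' hx⟩
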